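/- Let $1\le k<n$ be integers, $a=\frac{2n-k}{n-k}$ and $0<\sigma\le\frac{a-1}{8a^2}$. For $\varepsilon>0$ and $z\in\mathbb C^n$ put $$w^\varepsilon(z)=-\Big(\frac{|z|^2+\varepsilon^2}{1+\varepsilon^2}\Big)^{1-\frac nk},\qquad f^\varepsilon(z)=H_k(w^\varepsilon)(z)=\binom nk\Big(\frac nk-1\Big)^k\varepsilon^2(1+\varepsilon^2)^{n-k}(|z|^2+\varepsilon^2)^{-n-1},$$ where $H_k(v)$ is the $k$-th elementary symmetric polynomial of the eigenvalues of the complex Hessian $(v_{i\bar j})=(\partial^2v/\partial z_i\partial\bar z_j)$. Let $\Omega\subset\mathbb C^n$ be open with $0\in\Omega$ and $\overline\Omega\subset B_R=\{|z|<R\}$, and let $\Sigma_R=B_R\setminus\overline\Omega$. Let $u$ be a real function, smooth up to the boundary of $\Sigma_R$ (that is, on an open neighbourhood of $\overline{\Sigma_R}$), which is $k$-subharmonic in $\Sigma_R$ (that is, $H_i(u)\ge0$ for $1\le i\le k$) and satisfies $$H_k(u)=f^\varepsilon\ \text{ in }\Sigma_R,\qquad u=-1\ \text{ on }\partial\Omega,\qquad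 u=w^\varepsilon\ \text{ on }\partial B_R .$$ Write $|Dv|^2=\sum_l|\partial v/\partial z_l|^2$, let $|D^2v|$ be the operator norm of the real second derivative, and set $$P=|Du|^2(-u)^{-a},\quad M=2\max_{\overline{\Sigma_R}}P+1,\quad \psi(t)=(M-t)^{-\sigma},\quad H(z,\xi)=u_{\xi\bar\xi}(z)\,(-u(z))^{-\frac n{n-k}}\,\psi(P(z)),$$ where $u_{\xi\bar\xi}=\sum_{i,j}u_{i\bar j}\xi_i\bar\xi_j$ for $\xi\in\mathbb C^n$, $|\xi|=1$. Suppose that on $\overline{\Sigma_R}$ $$P\le K_0,\qquad (-u)^{-\frac k{n-k}}|D\log f^\varepsilon|^2\le K_1,\qquad (-u)^{-\frac k{n-k}}|D^2\log f^\varepsilon|\le K_2 .$$ Then $$\max_{z\in\overline{\Sigma_R},\,|\xi|=1}H(z,\xi)\le C+\max_{z\in\partial\Sigma_R,\,|\xi|=1}H(z,\xi),$$ where $C>0$ depends only on $n,k,\sigma,K_0,K_1,K_2$; in particular $C$ does not depend on $\varepsilon$, $R$, $\Omega$ or $u$. -/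

import Mathlib

open Set Metric Topology
open scoped ContDiff

namespace ExteriorHessian

noncomputable section

/-- `ℂⁿ` with its Hermitian norm `|z|² = ∑ |z_j|²`. -/
abbrev Cn (n : ℕ) : Type := EuclideanSpace ℂ (Fin n)

/-- The coordinate vector `∂/∂x_j` of `ℂⁿ`, where `z_j = x_j + i y_j`; the vector `∂/∂y_j` is
`Complex.I • unitVec j`. -/
def unitVec {n : ℕ} (j : Fin n) : Cn n := EuclideanSpace.single j (1 : ℂ)

/-- `∂g/∂z_j = (1/2) (∂g/∂x_j - i ∂g/∂y_j)`. -/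
def dz {n : ℕ} (j : Fin n) (g : Cn n → ℂ) (z : Cn n) : ℂ :=
  (1 / 2) * (fderiv ℝ g z (unitVec j) - Complex.I * fderiv ℝ g z (Complex.I • unitVec j))

/-- `∂g/∂z̄_j = (1/2) (∂g/∂x_j + i ∂g/∂y_j)`. -/
def dzbar {n : ℕ} (j : Fin n) (g : Cn n → ℂ) (z : Cn n) : ℂ :=
  (1 / 2) * (fderiv ℝ g z (unitVec j) + Complex.I * fderiv ℝ g z (Complex.I • unitVec j))

/-- A real function regarded as a complex valued one. -/
def toC {n : ℕ} (u : Cn n → ℝ) : Cn n → ℂ := fun z => (u z : ℂ)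

/-- `|Du|² = ∑_l u_l u_l̄`, where `u_l = ∂u/∂z_l`. -/
def gradSq {n : ℕ} (u : Cn n → ℝ) (z : Cn n) : ℝ :=
  ∑ l, ‖dz l (toC u) z‖ ^ 2

/-- The complex Hessian matrix `u_{i j̄} = ∂²u / ∂z_i ∂z̄_j`. -/
def cHess {n : ℕ} (u : Cn n → ℝ) (z : Cn n) : Matrix (Fin n) (Fin n) ℂ :=
  Matrix.of fun i j => dz i (fun w => dzbar j (toC u) w) z

/-- `u_{ξ ξ̄} = ∑_{i,j} u_{i j̄} ξ_i conj(ξ_j)`, a real number where `u` is `C²`. -/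
def levi {n : ℕ} (u : Cn n → ℝ) (z ξ : Cn n) : ℝ :=
  (∑ i, ∑ j, cHess u z i j * ξ i * (starRingEnd ℂ) (ξ j)).re

/-- The complex `k`-Hessian operator `H_k(u)`: the `k`-th elementary symmetric polynomial of the
eigenvalues (with multiplicity) of the complex Hessian. The eigenvalues are real where `u` is `C²`,
since the complex Hessian is then Hermitian. -/
def hessOp {n : ℕ} (k : ℕ) (u : Cn n → ℝ) (z : Cn n) : ℝ :=
  ((cHess u z).charpoly.roots.esymm k).re

/-- A `C²` function is `k`-subharmonic on `s` if at each point of `s` the eigenvalues of its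
complex Hessian lie in the closed cone `{λ : S_i(λ) ≥ 0 for 1 ≤ i ≤ k}`. -/
def KSubharmonicOn {n : ℕ} (k : ℕ) (u : Cn n → ℝ) (s : Set (Cn n)) : Prop :=
  ∀ z ∈ s, ∀ i : ℕ, 1 ≤ i → i ≤ k → 0 ≤ hessOp i u z

/-- The regularized Green function `w^ε(z) = -((|z|² + ε²)/(1 + ε²))^(1 - n/k)`. -/
def wEps (n k : ℕ) (ε : ℝ) (z : Cn n) : ℝ :=
  -(((‖z‖ ^ 2 + ε ^ 2) / (1 + ε ^ 2)) ^ (1 - (n : ℝ) / (k : ℝ)))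

/-- `f^ε(z) = C(n,k) (n/k - 1)^k ε² (1 + ε²)^(n-k) (|z|² + ε²)^(-n-1)`, which is `H_k(w^ε)`.
Used for `1 ≤ k < n` only. -/
def fEps (n k : ℕ) (ε : ℝ) (z : Cn n) : ℝ :=
  (n.choose k : ℝ) * ((n : ℝ) / (k : ℝ) - 1) ^ k * ε ^ 2 * (1 + ε ^ 2) ^ (n - k) /
    (‖z‖ ^ 2 + ε ^ 2) ^ (n + 1)

/-- `log f^ε`. -/
def logf (n k : ℕ) (ε : ℝ) (z : Cn n) : ℝ := Real.log (fEps n k ε z)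

/-- The region between `Ω` and the sphere of radius `R` centred at the origin: the open set
`B_R ∖ closure Ω`. -/
def Sig {n : ℕ} (Ω : Set (Cn n)) (R : ℝ) : Set (Cn n) := ball 0 R \ closure Ω

/-- `u` is a `k`-subharmonic solution, smooth up to the boundary, of the approximating problem
`H_k(u) = f^ε` between `Ω` and the sphere `∂B_R`, with `u = -1` on `∂Ω` and `u = w^ε` on `∂B_R`.
Smooth up to the boundary: `u` is smooth on an open neighbourhood of the closed region, so that the
derivatives at boundary points are those of `u`. -/
structure IsApproxSolution {n : ℕ} (k : ℕ) (Ω : Set (Cn n)) (R ε : ℝ) (u : Cn n → ℝ) : Prop where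
  smooth : ∃ U : Set (Cn n), IsOpen U ∧ closure (Sig Ω R) ⊆ U ∧ ContDiffOn ℝ ∞ u U
  subharmonic : KSubharmonicOn k u (Sig Ω R)
  equation : ∀ z ∈ Sig Ω R, hessOp k u z = fEps n k ε z
  inner_bdry : ∀ z ∈ frontier Ω, u z = -1
  outer_bdry : ∀ z ∈ sphere (0 : Cn n) R, u z = wEps n k ε z

/-- The exponent `a = (2n - k)/(n - k)`. -/
def expA (n k : ℕ) : ℝ := (2 * (n : ℝ) - k) / ((n : ℝ) - k)

/-- `P = |Du|² (-u)^(-(2n-k)/(n-k))`. -/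
def auxP {n : ℕ} (k : ℕ) (u : Cn n → ℝ) (z : Cn n) : ℝ :=
  gradSq u z * (-u z) ^ (-expA n k)

/-- `M = 2 max P + 1`, the maximum being over the closed region (where `P` is continuous, the
region being compact and a solution being negative on it). -/
def auxM {n : ℕ} (k : ℕ) (Ω : Set (Cn n)) (R : ℝ) (u : Cn n → ℝ) : ℝ :=
  2 * sSup (auxP k u '' closure (Sig Ω R)) + 1

/-- `H(z, ξ) = u_{ξ ξ̄} (-u)^(-n/(n-k)) ψ(P)` with `ψ(t) = (M - t)^(-σ)`. -/
def auxH {n : ℕ} (k : ℕ) (σ : ℝ) (Ω : Set (Cn n)) (R : ℝ) (u : Cn n → ℝ) (z ξ : Cn n) : ℝ :=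
  levi u z ξ * (-u z) ^ (-((n : ℝ) / ((n : ℝ) - k))) * (auxM k Ω R u - auxP k u z) ^ (-σ)

end

end ExteriorHessian

/-! This is a maximum principle for `H`. If the maximum over the compact set of pairs `(z, ξ)` is
attained over the frontier, nothing is needed. Otherwise it sits at an interior point `z`, where
`interior_estimate` bounds it by a constant. Some frontier value of `H` is nonnegative, so that
constant can be absorbed into `C`.

At `z`, choose a unitary frame `e` diagonalizing the complex Hessian, with eigenvalues `x` and
largest one `x o`. Fix the direction `e o`. Then `log H` has a local maximum at `z` along each of
the `2n` real lines of the frame. This gives a first and a second order condition per line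
(`test_function_conditions`). The second order ones are summed with the weights `w i = S_{k-1}` of
`x` without `x i`, the coefficients of the linearized operator. Three facts feed this sum.

Differentiating the equation twice and using concavity of `log S_k` on the Gårding cone bounds the
linearized operator on `u_{oō}` from below by second derivatives of `log f` plus positive third
order terms. Those terms come from the off-diagonal entries of the differentiated Hessian
(`ClosedCone.second_derivative_le`, `linearized_leviForm_ge`). Concavity itself rests on Newton's
inequality and on superadditivity of `S_{k+1}/S_k` (`OpenCone.add_and_le`).

The linearized operator on `|Du|²` produces the good term `4 ∑ w i * x i ^ 2`, up to data
(`linearized_gradSq_ge`).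

The bad term `w i * (L_i / L)^2`, where `L = u_{oō}`, is reduced by the third order terms to a
coefficient which is at most a small multiple of `w i`, except for an error controlled by `∑ w i * x
i ^ 2 / x o ^ 2` (`bad_coefficient_le`). The first order condition and the smallness of `σ` absorb
the small multiple (`direction_bound`).

What is left is an inequality in which `∑ w i * x i ^ 2 ≥ (k/n) f x o` dominates once `x o` is large
compared with `(-u)^(n/(n-k))`. All powers of `-u` cancel, so the bound on `x o * (-u)^(-n/(n-k))`
involves only the allowed constants (`eigenvalue_le_of_test_conditions`). -/

/-! ### Elementary symmetric functions of a finite family -/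

/-- The `k`-th elementary symmetric function of the family `x` on `s`. -/
def esym {ι R : Type*} [CommSemiring R] (s : Finset ι) (k : ℕ) (x : ι → R) : R :=
  ∑ t ∈ s.powersetCard k, ∏ i ∈ t, x i

/-- `esym` with its index lowered by one, and `0` at index `0`. -/
def esymPred {ι R : Type*} [CommSemiring R] (s : Finset ι) : ℕ → (ι → R) → R
  | 0, _ => 0
  | m + 1, x => esym s m x

theorem esymPred_zero {ι R : Type*} [CommSemiring R] (s : Finset ι) (x : ι → R) :
    esymPred s 0 x = 0 := rfl

theorem esymPred_succ {ι R : Type*} [CommSemiring R] (s : Finset ι) (m : ℕ) (x : ι → R) :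
    esymPred s (m + 1) x = esym s m x := rfl

theorem esym_zero {ι R : Type*} [CommSemiring R] (s : Finset ι) (x : ι → R) :
    esym s 0 x = 1 := by
  simp [esym]

theorem esym_eq_zero {ι R : Type*} [CommSemiring R] {s : Finset ι} {k : ℕ} (h : s.card < k)
    (x : ι → R) : esym s k x = 0 := by
  simp [esym, Finset.powersetCard_eq_empty.2 h]

theorem esym_empty {ι R : Type*} [CommSemiring R] (k : ℕ) (x : ι → R) :
    esym (∅ : Finset ι) (k + 1) x = 0 :=
  esym_eq_zero (by simp) x

theorem continuous_esym {ι : Type*} (s : Finset ι) (k : ℕ) :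
    Continuous fun x : ι → ℝ => esym s k x := by
  unfold esym
  fun_prop

section esym
variable {ι : Type*} [DecidableEq ι]

theorem esym_insert {R : Type*} [CommSemiring R] {s : Finset ι} {i : ι} (hi : i ∉ s) (k : ℕ)
    (x : ι → R) : esym (insert i s) (k + 1) x = x i * esym s k x + esym s (k + 1) x := by
  unfold esym
  rw [Finset.powersetCard_succ_insert hi, Finset.sum_union, add_comm, Finset.sum_image,
    Finset.mul_sum]
  · congr 1
    refine Finset.sum_congr rfl fun t ht => ?_
    rw [Finset.prod_insert]
    exact fun h => hi ((Finset.mem_powersetCard.1 ht).1 h)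
  · intro t ht t' ht' h
    have h1 : i ∉ t := fun h => hi ((Finset.mem_powersetCard.1 ht).1 h)
    have h2 : i ∉ t' := fun h => hi ((Finset.mem_powersetCard.1 ht').1 h)
    rw [← Finset.erase_insert h1, ← Finset.erase_insert h2]
    rw [h]
  · rw [Finset.disjoint_left]
    intro t ht ht'
    obtain ⟨t', -, rfl⟩ := Finset.mem_image.1 ht'
    exact hi ((Finset.mem_powersetCard.1 ht).1 (Finset.mem_insert_self i t'))

theorem esym_erase {R : Type*} [CommSemiring R] {s : Finset ι} {i : ι} (hi : i ∈ s) (k : ℕ)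
    (x : ι → R) :
    esym s (k + 1) x = x i * esym (s.erase i) k x + esym (s.erase i) (k + 1) x := by
  conv_lhs => rw [← Finset.insert_erase hi]
  exact esym_insert (Finset.notMem_erase i s) k x

theorem esym_erase_pred {R : Type*} [CommSemiring R] {s : Finset ι} {i : ι} (hi : i ∈ s) (k : ℕ)
    (x : ι → R) :
    esym s k x = x i * esymPred (s.erase i) k x + esym (s.erase i) k x := by
  cases k with
  | zero => simp [esym_zero, esymPred]
  | succ k => exact esym_erase hi k x

/-- Euler's identity: each monomial of degree `k + 1` is counted once for each of its factors. -/
theorem sum_mul_esym_erase {R : Type*} [CommRing R] (s : Finset ι) (k : ℕ) (x : ι → R) :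
    ∑ i ∈ s, x i * esym (s.erase i) k x = (k + 1) * esym s (k + 1) x := by
  induction s using Finset.induction_on generalizing k with
  | empty => simp [esym_empty]
  | insert a s ha ih =>
    rw [Finset.sum_insert ha, Finset.erase_insert ha]
    have key : ∀ i ∈ s, x i * esym ((insert a s).erase i) k x =
        x a * (x i * esymPred (s.erase i) k x) + x i * esym (s.erase i) k x := by
      intro i hi
      have hne : a ≠ i := fun h => ha (h ▸ hi)
      have hm : a ∈ (insert a s).erase i := by simp [hne]
      rw [esym_erase_pred hm, Finset.erase_right_comm, Finset.erase_insert ha]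
      ring
    rw [Finset.sum_congr rfl key, Finset.sum_add_distrib, ← Finset.mul_sum, ih,
      esym_insert ha]
    cases k with
    | zero => simp [esymPred, esym_zero]
    | succ k =>
      simp only [esymPred]
      rw [ih]
      push_cast
      ring

theorem sum_esym_erase {R : Type*} [CommRing R] (s : Finset ι) (k : ℕ) (x : ι → R) :
    ∑ i ∈ s, esym (s.erase i) k x = ((s.card : R) - k) * esym s k x := by
  have h2 : ∑ i ∈ s, esym s k x = s.card * esym s k x := by simp
  cases k with
  | zero => simp [esym_zero]
  | succ k =>
    have h1 := sum_mul_esym_erase s k x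
    rw [Finset.sum_congr rfl fun i hi => esym_erase hi k x, Finset.sum_add_distrib, h1] at h2
    push_cast
    linear_combination h2

/-- The derivative of `esym s k` at `x` in the direction `y`. -/
def esymDeriv (s : Finset ι) (k : ℕ) (x y : ι → ℝ) : ℝ :=
  ∑ i ∈ s, y i * esymPred (s.erase i) k x

/-- The second derivative of `esym s k` at `x` in the direction `y`. -/
def esymDeriv₂ (s : Finset ι) (k : ℕ) (x y : ι → ℝ) : ℝ :=
  ∑ i ∈ s, ∑ j ∈ s.erase i, y i * y j * esymPred ((s.erase i).erase j) (k - 1) x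

theorem hasDerivAt_esym (s : Finset ι) (k : ℕ) (x y : ι → ℝ) (t : ℝ) :
    HasDerivAt (fun t : ℝ => esym s k (x + t • y)) (esymDeriv s k (x + t • y) y) t := by
  induction s using Finset.induction_on generalizing k with
  | empty =>
    cases k with
    | zero => simpa [esym_zero, esymDeriv] using hasDerivAt_const t (1 : ℝ)
    | succ k => simpa [esym_empty, esymDeriv] using hasDerivAt_const t (0 : ℝ)
  | insert a s ha ih =>
    cases k with
    | zero => simpa [esym_zero, esymDeriv, esymPred] using hasDerivAt_const t (1 : ℝ)
    | succ k =>
      simp only [esym_insert ha]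
      have h1 : HasDerivAt (fun t : ℝ => (x + t • y) a) (y a) t := by
        simpa using ((hasDerivAt_id t).mul_const (y a)).const_add (x a)
      convert! (h1.mul (ih k)).add (ih (k + 1)) using 1
      unfold esymDeriv
      rw [Finset.sum_insert ha, Finset.erase_insert ha]
      have key : ∀ i ∈ s, y i * esymPred ((insert a s).erase i) (k + 1) (x + t • y) =
          (x + t • y) a * (y i * esymPred (s.erase i) k (x + t • y)) +
            y i * esymPred (s.erase i) (k + 1) (x + t • y) := by
        intro i hi
        have hne : a ≠ i := fun h => ha (h ▸ hi)
        have hm : a ∈ (insert a s).erase i := by simp [hne]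
        rw [esymPred_succ, esymPred_succ, esym_erase_pred hm, Finset.erase_right_comm, Finset.erase_insert ha]
        ring
      rw [Finset.sum_congr rfl key, Finset.sum_add_distrib, ← Finset.mul_sum]
      rw [esymPred_succ]
      simp only [esymPred_succ]
      ring

theorem hasDerivAt_esymDeriv (s : Finset ι) (k : ℕ) (x y : ι → ℝ) (t : ℝ) :
    HasDerivAt (fun t : ℝ => esymDeriv s k (x + t • y) y) (esymDeriv₂ s k (x + t • y) y) t := by
  unfold esymDeriv esymDeriv₂
  refine HasDerivAt.fun_sum fun i _ => ?_
  cases k with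
  | zero => simpa [esymPred] using hasDerivAt_const t (0 : ℝ)
  | succ k =>
    convert! (hasDerivAt_esym (s.erase i) k x y t).const_mul (y i) using 1
    simp [esymDeriv, Finset.mul_sum, mul_assoc]

end esym

/-! ### Newton's inequality -/

section Newton
open Polynomial

theorem Polynomial.Splits.derivative_real {p : ℝ[X]} (hp : p.Splits) : p.derivative.Splits := by
  by_cases h0 : p.derivative = 0
  · rw [h0]; exact Splits.zero
  rw [splits_iff_card_roots] at hp ⊢
  have h1 := card_roots_le_derivative p
  have h2 := p.derivative.card_roots'
  have h3 := natDegree_derivative_le p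
  have h4 : p.natDegree ≠ 0 := fun h => h0 (derivative_of_natDegree_zero h)
  omega

/-- By Rolle, passing to the derivative loses at most one root, which matches the drop in degree. -/
theorem Polynomial.Splits.iterate_derivative_real {p : ℝ[X]} (hp : p.Splits) (k : ℕ) :
    (derivative^[k] p).Splits := by
  induction k with
  | zero => exact hp
  | succ k ih => rw [Function.iterate_succ_apply']; exact ih.derivative_real

/-- Laguerre's inequality for real-rooted polynomials. -/
theorem Polynomial.Splits.eval_mul_eval_derivative_derivative_le {p : ℝ[X]} (hp : p.Splits)
    (x : ℝ) : p.eval x * p.derivative.derivative.eval x ≤ p.derivative.eval x ^ 2 := by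
  have key : ∀ m : Multiset ℝ, (m.map (fun a => X - C a)).prod.eval x *
      (m.map (fun a => X - C a)).prod.derivative.derivative.eval x ≤
        (m.map (fun a => X - C a)).prod.derivative.eval x ^ 2 := by
    intro m
    induction m using Multiset.induction_on with
    | empty => simp
    | cons a m ih =>
      simp only [Multiset.map_cons, Multiset.prod_cons, derivative_mul, derivative_add,
        derivative_sub, derivative_X, derivative_C, eval_add, eval_mul, eval_sub, eval_X, eval_C,
        sub_zero, one_mul]
      -- For `p = (X - a) q` one has `p'^2 - p p'' = q^2 + (x - a)^2 (q'^2 - q q'')`.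
      nlinarith [mul_le_mul_of_nonneg_left ih (sq_nonneg (x - a)),
        sq_nonneg ((m.map (fun a => X - C a)).prod.eval x)]
  rw [hp.eq_prod_roots]
  have h := mul_le_mul_of_nonneg_left (key p.roots) (sq_nonneg p.leadingCoeff)
  simp only [derivative_mul, derivative_C, zero_mul, zero_add, eval_mul, eval_C]
  nlinarith

/-- This is Laguerre's inequality at `0` for the `k`-th derivative, whose Taylor coefficients are
those of `p` up to factorials. The gain `(k + 1)/(k + 2)` is discarded. -/
theorem Polynomial.Splits.coeff_mul_coeff_le {p : ℝ[X]} (hp : p.Splits) (k : ℕ) :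
    p.coeff k * p.coeff (k + 2) ≤ p.coeff (k + 1) ^ 2 := by
  have h := (hp.iterate_derivative_real k).eval_mul_eval_derivative_derivative_le 0
  rw [← Function.iterate_succ_apply' derivative k p,
    ← Function.iterate_succ_apply' derivative (k + 1) p] at h
  simp only [← coeff_zero_eq_eval_zero, coeff_iterate_derivative, zero_add,
    Nat.descFactorial_self, nsmul_eq_mul] at h
  rcases le_or_gt (p.coeff k * p.coeff (k + 2)) 0 with h0 | h0
  · exact h0.trans (sq_nonneg _)
  have hf : (0 : ℝ) < (Nat.factorial k : ℝ) := by exact_mod_cast Nat.factorial_pos k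
  have e1 : ((Nat.factorial (k + 1) : ℕ) : ℝ) = (k + 1) * Nat.factorial k := by
    push_cast [Nat.factorial_succ]; ring
  have e2 : ((Nat.factorial (k + 2) : ℕ) : ℝ) = (k + 2) * ((k + 1) * Nat.factorial k) := by
    push_cast [Nat.factorial_succ]; ring
  simp only [Nat.succ_eq_add_one] at h
  rw [e1, show k + 1 + 1 = k + 2 from rfl, e2] at h
  have hk : (0 : ℝ) ≤ k := Nat.cast_nonneg k
  have h' : ((k : ℝ) + 2) * (p.coeff k * p.coeff (k + 2)) ≤
      (k + 1) * p.coeff (k + 1) ^ 2 := by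
    have : (Nat.factorial k : ℝ) ^ 2 * (k + 1) * (((k : ℝ) + 2) * (p.coeff k * p.coeff (k + 2))) ≤
      (Nat.factorial k : ℝ) ^ 2 * (k + 1) * ((k + 1) * p.coeff (k + 1) ^ 2) := by nlinarith
    exact le_of_mul_le_mul_left this (by positivity)
  nlinarith

theorem coeff_prod_one_add {ι : Type*} [DecidableEq ι] (s : Finset ι) (x : ι → ℝ) (k : ℕ) :
    (∏ i ∈ s, (1 + C (x i) * X)).coeff k = esym s k x := by
  induction s using Finset.induction_on generalizing k with
  | empty =>
    cases k with
    | zero => simp [esym_zero]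
    | succ k => simp [esym_empty, coeff_one]
  | insert a s ha ih =>
    rw [Finset.prod_insert ha, add_mul, one_mul, coeff_add, ih, mul_assoc, coeff_C_mul]
    cases k with
    | zero => simp [esym_zero]
    | succ k => rw [coeff_X_mul, ih, esym_insert ha]; ring

theorem splits_prod_one_add {ι : Type*} [DecidableEq ι] (s : Finset ι) (x : ι → ℝ) :
    (∏ i ∈ s, (1 + C (x i) * X) : ℝ[X]).Splits := by
  refine Splits.prod fun i _ => Splits.of_natDegree_le_one ?_
  compute_degree

/-- Newton's inequality, without the binomial factor. -/
theorem esym_mul_esym_le {ι : Type*} [DecidableEq ι] (s : Finset ι) (x : ι → ℝ) (k : ℕ) :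
    esym s k x * esym s (k + 2) x ≤ esym s (k + 1) x ^ 2 := by
  simpa only [coeff_prod_one_add] using (splits_prod_one_add s x).coeff_mul_coeff_le k

end Newton

/-! ### The Gårding cones -/

/-- The open cone `{S_j > 0, j ≤ k}`. -/
def OpenCone {ι : Type*} (s : Finset ι) (k : ℕ) (x : ι → ℝ) : Prop := ∀ j ≤ k, 0 < esym s j x

/-- The closed cone `{S_j ≥ 0, j ≤ k}`. -/
def ClosedCone {ι : Type*} (s : Finset ι) (k : ℕ) (x : ι → ℝ) : Prop := ∀ j ≤ k, 0 ≤ esym s j x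

theorem OpenCone.mono {ι : Type*} {s : Finset ι} {k l : ℕ} {x : ι → ℝ} (h : OpenCone s k x) (hl : l ≤ k) :
    OpenCone s l x := fun j hj => h j (hj.trans hl)

section Cone
variable {ι : Type*} [DecidableEq ι]

/-- Write `p, q, r` for the consecutive functions of the erased family. If `q ≤ 0`, then `x i * p +
q > 0` and `x i * q + r > 0` force `p * r > q ^ 2`, against Newton's inequality. -/
theorem OpenCone.erase {s : Finset ι} {k : ℕ} {x : ι → ℝ} (h : OpenCone s (k + 1) x) {i : ι}
    (hi : i ∈ s) : OpenCone (s.erase i) k x := by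
  induction k with
  | zero =>
    intro j hj
    obtain rfl : j = 0 := by omega
    simp [esym_zero]
  | succ k ih =>
    have ih' := ih (h.mono (by omega))
    intro j hj
    rcases Nat.lt_or_ge j (k + 1) with hj' | hj'
    · exact ih' j (by omega)
    obtain rfl : j = k + 1 := by omega
    have h1 := h (k + 1) (by omega)
    have h2 := h (k + 2) le_rfl
    have hp := ih' k le_rfl
    have hN := esym_mul_esym_le (s.erase i) x k
    rw [esym_erase hi] at h1 h2
    by_contra! hq
    set p := esym (s.erase i) k x
    set q := esym (s.erase i) (k + 1) x
    set r := esym (s.erase i) (k + 2) x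
    have a1 : 0 ≤ (x i * p + q) * (-q) := mul_nonneg h1.le (by linarith)
    have a2 : 0 < p * (x i * q + r) := mul_pos hp h2
    nlinarith

/-- The Marcus-Lopes identity. -/
theorem marcus_lopes {s : Finset ι} {k : ℕ} {x : ι → ℝ} (h : OpenCone s (k + 1) x) :
    (k + 2) * (esym s (k + 2) x / esym s (k + 1) x) =
      ∑ i ∈ s, (x i - x i ^ 2 / (esym s (k + 1) x / esym (s.erase i) k x)) := by
  have h1 := h (k + 1) le_rfl
  have hs := sum_mul_esym_erase s (k + 1) x
  push_cast at hs
  rw [← mul_div_assoc, show ((k : ℝ) + 2) = k + 1 + 1 by ring, ← hs, Finset.sum_div]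
  refine Finset.sum_congr rfl fun i hi => ?_
  have h2 := h.erase hi k le_rfl
  have h3 := esym_erase hi k x
  field_simp
  rw [h3]
  ring

/-- The function `a ^ 2 / c` is convex and homogeneous of degree one, hence subadditive. -/
theorem sq_div_add_le {a b c d : ℝ} (hc : 0 < c) (hd : 0 < d) :
    (a + b) ^ 2 / (c + d) ≤ a ^ 2 / c + b ^ 2 / d := by
  rw [div_add_div _ _ hc.ne' hd.ne', div_le_div_iff₀ (by positivity) (by positivity)]
  nlinarith [sq_nonneg (a * d - b * c), mul_pos hc hd]

/-- The Gårding cone is convex and the quotients `S_{k+1}/S_k` are superadditive on it. -/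
theorem OpenCone.add_and_le {s : Finset ι} {k : ℕ} {x y : ι → ℝ} (hx : OpenCone s (k + 1) x)
    (hy : OpenCone s (k + 1) y) :
    OpenCone s (k + 1) (x + y) ∧ esym s (k + 1) x / esym s k x + esym s (k + 1) y / esym s k y ≤
      esym s (k + 1) (x + y) / esym s k (x + y) := by
  induction k generalizing s with
  | zero =>
    have e : ∀ z : ι → ℝ, esym s 1 z = ∑ i ∈ s, z i := fun z => by
      simpa [esym_zero] using (sum_mul_esym_erase s 0 z).symm
    have h : esym s 1 (x + y) = esym s 1 x + esym s 1 y := by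
      simp [e, Finset.sum_add_distrib]
    refine ⟨fun j hj => ?_, by simp [esym_zero, h]⟩
    interval_cases j
    · simp [esym_zero]
    · rw [h]; exact add_pos (hx 1 le_rfl) (hy 1 le_rfl)
  | succ k ih =>
    have hxy := (ih (hx.mono (by omega)) (hy.mono (by omega))).1
    have hpos := hxy (k + 1) le_rfl
    -- These are the denominators in the Marcus-Lopes identity. Each is `z i` plus a quotient of
    -- lower order for `s.erase i`, so the induction hypothesis makes it superadditive.
    set Q : ι → (ι → ℝ) → ℝ := fun i z => esym s (k + 1) z / esym (s.erase i) k z with hQ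
    have hQpos : ∀ i ∈ s, ∀ z, OpenCone s (k + 1) z → 0 < Q i z := fun i hi z hz =>
      div_pos (hz _ le_rfl) (hz.erase hi k le_rfl)
    have hQe : ∀ i ∈ s, ∀ z, OpenCone s (k + 1) z →
        Q i z = z i + esym (s.erase i) (k + 1) z / esym (s.erase i) k z := by
      intro i hi z hz
      have := hz.erase hi k le_rfl
      rw [hQ]
      simp only
      rw [esym_erase hi]
      field_simp
    have hQs : ∀ i ∈ s, Q i x + Q i y ≤ Q i (x + y) := by
      intro i hi
      rw [hQe i hi x (hx.mono (by omega)), hQe i hi y (hy.mono (by omega)), hQe i hi _ hxy]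
      have := (ih (hx.erase hi) (hy.erase hi)).2
      simp only [Pi.add_apply]
      linarith
    have hsum : ((k : ℝ) + 2) * (esym s (k + 2) x / esym s (k + 1) x +
        esym s (k + 2) y / esym s (k + 1) y) ≤
        ∑ i ∈ s, ((x + y) i - (x + y) i ^ 2 / Q i (x + y)) := by
      rw [mul_add, marcus_lopes (hx.mono (by omega)), marcus_lopes (hy.mono (by omega)), ← Finset.sum_add_distrib]
      refine Finset.sum_le_sum fun i hi => ?_
      have p1 := hQpos i hi x (hx.mono (by omega))
      have p2 := hQpos i hi y (hy.mono (by omega))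
      have e1 := sq_div_add_le (a := x i) (b := y i) p1 p2
      have e2 : (x i + y i) ^ 2 / Q i (x + y) ≤ (x i + y i) ^ 2 / (Q i x + Q i y) :=
        div_le_div_of_nonneg_left (sq_nonneg _) (by positivity) (hQs i hi)
      simp only [Pi.add_apply]
      change x i - x i ^ 2 / Q i x + (y i - y i ^ 2 / Q i y) ≤ _
      linarith
    -- The identity for `x + y` needs only the cone of order `k + 1`. Positivity of `S_{k+2} (x +
    -- y)` is thus a consequence of the quotient inequality.
    rw [← marcus_lopes hxy] at hsum
    have hk : (0 : ℝ) < k + 2 := by positivity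
    have hle := le_of_mul_le_mul_left hsum hk
    refine ⟨fun j hj => ?_, hle⟩
    rcases Nat.lt_or_ge j (k + 2) with hj' | hj'
    · exact hxy j (by omega)
    obtain rfl : j = k + 2 := by omega
    have : 0 < esym s (k + 2) x / esym s (k + 1) x + esym s (k + 2) y / esym s (k + 1) y :=
      add_pos (div_pos (hx _ le_rfl) (hx _ (by omega))) (div_pos (hy _ le_rfl) (hy _ (by omega)))
    exact (div_pos_iff_of_pos_right hpos).1 (this.trans_le hle)

end Cone

/-! ### The second derivative test -/

/-- A positive second derivative at a critical point would make it a local minimum too. The function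
would then be locally constant, with vanishing second derivative. -/
theorem IsLocalMax.second_derivative_nonpos {f f₁ : ℝ → ℝ} {f₂ t : ℝ} (hmax : IsLocalMax f t)
    (h₁ : ∀ᶠ s in 𝓝 t, HasDerivAt f (f₁ s) s) (h₂ : HasDerivAt f₁ f₂ t) :
    f₁ t = 0 ∧ f₂ ≤ 0 := by
  have h0 : f₁ t = 0 := hmax.hasDerivAt_eq_zero h₁.self_of_nhds
  refine ⟨h0, ?_⟩
  by_contra! hpos
  have he : deriv f =ᶠ[𝓝 t] f₁ := h₁.mono fun s hs => hs.deriv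
  have hd2 : deriv (deriv f) t = f₂ := by rw [he.deriv_eq, h₂.deriv]
  have hmin : IsLocalMin f t := isLocalMin_of_deriv_deriv_pos (by rw [hd2]; exact hpos)
    (by rw [he.self_of_nhds, h0]) h₁.self_of_nhds.continuousAt
  have hc : f =ᶠ[𝓝 t] fun _ => f t := by
    filter_upwards [hmax, hmin] with s h1 h2 using le_antisymm h1 h2
  have hc1 : deriv f =ᶠ[𝓝 t] fun _ => 0 := by
    simpa using hc.deriv
  rw [hc1.deriv_eq] at hd2
  simp at hd2
  linarith

/-! ### Concavity of the logarithm of an elementary symmetric function -/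

theorem esym_smul {ι : Type*} (s : Finset ι) (k : ℕ) (c : ℝ) (x : ι → ℝ) :
    esym s k (c • x) = c ^ k * esym s k x := by
  unfold esym
  rw [Finset.mul_sum]
  refine Finset.sum_congr rfl fun t ht => ?_
  simp [Finset.prod_mul_distrib, (Finset.mem_powersetCard.1 ht).2]

theorem isOpen_openCone {ι : Type*} (s : Finset ι) (k : ℕ) :
    IsOpen {x : ι → ℝ | OpenCone s k x} := by
  have : {x : ι → ℝ | OpenCone s k x} = ⋂ j ∈ Set.Iic k, {x | 0 < esym s j x} := by
    ext x
    simp [OpenCone]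
  rw [this]
  exact (Set.finite_Iic k).isOpen_biInter fun j _ => isOpen_lt continuous_const
    (continuous_esym s j)

theorem continuous_esymPred {ι : Type*} (s : Finset ι) (k : ℕ) : Continuous fun x : ι → ℝ => esymPred s k x := by
  cases k with
  | zero => exact continuous_const
  | succ k => exact continuous_esym s k

section Concavity
variable {ι : Type*} [DecidableEq ι]

/-- Midpoint log-concavity: `S_k` is the product of the quotients `S_{j+1}/S_j`, and superadditivity
`p + q ≤ 2 r` of each gives `p * q ≤ r ^ 2`. -/
theorem OpenCone.esym_mul_esym_le {s : Finset ι} {k : ℕ} {x y : ι → ℝ}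
    (h₁ : OpenCone s k (x + y)) (h₂ : OpenCone s k (x - y)) :
    esym s k (x + y) * esym s k (x - y) ≤ esym s k x ^ 2 := by
  induction k with
  | zero => simp [esym_zero]
  | succ k ih =>
    have ih' := ih (h₁.mono (by omega)) (h₂.mono (by omega))
    have hq := (h₁.add_and_le h₂)
    have e2 : x + y + (x - y) = (2 : ℝ) • x := by rw [two_smul]; abel
    rw [e2] at hq
    obtain ⟨hc, hq⟩ := hq
    rw [esym_smul, esym_smul] at hq
    have hx : ∀ j ≤ k + 1, 0 < esym s j x := fun j hj => by
      have := hc j hj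
      rw [esym_smul] at this
      exact pos_of_mul_pos_right this (by positivity)
    have a0 := h₁ k (by omega)
    have a1 := h₁ (k + 1) le_rfl
    have b0 := h₂ k (by omega)
    have b1 := h₂ (k + 1) le_rfl
    have c0 := hx k (by omega)
    have c1 := hx (k + 1) le_rfl
    set p := esym s (k + 1) (x + y) / esym s k (x + y) with hp
    set q := esym s (k + 1) (x - y) / esym s k (x - y) with hq'
    set r := esym s (k + 1) x / esym s k x with hr
    have hp0 : 0 < p := div_pos a1 a0
    have hq0 : 0 < q := div_pos b1 b0
    have hr2 : p + q ≤ 2 * r := by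
      refine hq.trans (le_of_eq ?_)
      rw [hr, pow_succ]
      field_simp
    have hpq : p * q ≤ r ^ 2 := by nlinarith [sq_nonneg (p - q)]
    have e1 : esym s (k + 1) (x + y) = p * esym s k (x + y) := by rw [hp]; field_simp
    have e2 : esym s (k + 1) (x - y) = q * esym s k (x - y) := by rw [hq']; field_simp
    have e3 : esym s (k + 1) x = r * esym s k x := by rw [hr]; field_simp
    rw [e1, e2, e3]
    calc p * esym s k (x + y) * (q * esym s k (x - y))
        = (p * q) * (esym s k (x + y) * esym s k (x - y)) := by ring
      _ ≤ r ^ 2 * esym s k x ^ 2 := mul_le_mul hpq ih' (by positivity) (by positivity)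
      _ = (r * esym s k x) ^ 2 := by ring

/-- On the open Gårding cone `log S_k` is concave. -/
theorem OpenCone.esym_mul_esymDeriv₂_le {s : Finset ι} {k : ℕ} {x : ι → ℝ} (h : OpenCone s k x)
    (y : ι → ℝ) : esym s k x * esymDeriv₂ s k x y ≤ esymDeriv s k x y ^ 2 := by
  have hE := fun t => hasDerivAt_esym s k x y t
  have hE1 := fun t => hasDerivAt_esymDeriv s k x y t
  have hE' : ∀ t, HasDerivAt (fun t : ℝ => esym s k (x + (-t) • y))
      (-esymDeriv s k (x + (-t) • y) y) t := fun t => by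
    simpa [Function.comp_def] using (hE (-t)).comp t (hasDerivAt_neg t)
  have hE1' : ∀ t, HasDerivAt (fun t : ℝ => esymDeriv s k (x + (-t) • y) y)
      (-esymDeriv₂ s k (x + (-t) • y) y) t := fun t => by
    simpa [Function.comp_def] using (hE1 (-t)).comp t (hasDerivAt_neg t)
  -- The second derivative of this product at `0` is twice `S S'' - S'^2`.
  have hmax : IsLocalMax (fun t : ℝ => esym s k (x + t • y) * esym s k (x + (-t) • y)) 0 := by
    have o1 : ∀ᶠ t : ℝ in 𝓝 0, OpenCone s k (x + t • y) := by
      have hc : ContinuousAt (fun t : ℝ => x + t • y) 0 := by fun_prop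
      exact hc.eventually ((isOpen_openCone s k).mem_nhds (by simpa using h))
    have o2 : ∀ᶠ t : ℝ in 𝓝 0, OpenCone s k (x - t • y) := by
      have hc : ContinuousAt (fun t : ℝ => x - t • y) 0 := by fun_prop
      exact hc.eventually ((isOpen_openCone s k).mem_nhds (by simpa using h))
    filter_upwards [o1, o2] with t h1 h2
    have := h1.esym_mul_esym_le h2
    simpa [sub_eq_add_neg, sq] using this
  have h2 := (hmax.second_derivative_nonpos (Filter.Eventually.of_forall fun t =>
    (hE t).mul (hE' t)) (((hE1 0).mul (hE' 0)).add ((hE 0).mul (hE1' 0).neg))).2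
  simp at h2
  nlinarith

/-- The derivative of `S_{j+1} (x + t • 1)` is `(card - j) S_j (x + t • 1)`, so positivity climbs
from `j` to `j + 1`. This allows statements on the open cone to pass to the closed one as `t`
decreases to `0`. -/
theorem ClosedCone.openCone_add {s : Finset ι} {k : ℕ} {x : ι → ℝ} (h : ClosedCone s k x)
    (hk : k ≤ s.card) {t : ℝ} (ht : 0 < t) : OpenCone s k (x + t • 1) := by
  intro j hj
  induction j generalizing t with
  | zero => simp [esym_zero]
  | succ j ih =>
    have hd : ∀ t : ℝ, HasDerivAt (fun t : ℝ => esym s (j + 1) (x + t • 1))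
        (((s.card : ℝ) - j) * esym s j (x + t • 1)) t := fun t => by
      convert hasDerivAt_esym s (j + 1) x 1 t using 1
      simp [esymDeriv, esymPred_succ, sum_esym_erase]
    have hm : StrictMonoOn (fun t : ℝ => esym s (j + 1) (x + t • 1)) (Set.Ici 0) := by
      refine strictMonoOn_of_deriv_pos (convex_Ici 0)
        (fun t _ => (hd t).continuousAt.continuousWithinAt) fun t ht => ?_
      rw [interior_Ici] at ht
      rw [(hd t).deriv]
      have : (j : ℝ) + 1 ≤ s.card := by exact_mod_cast hj.trans hk
      exact mul_pos (by linarith) (ih ht (by omega))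
    have := hm (Set.self_mem_Ici) ht.le ht
    simp only [zero_smul, add_zero] at this
    exact (h (j + 1) hj).trans_lt this

theorem ClosedCone.erase {s : Finset ι} {k : ℕ} {x : ι → ℝ} (h : ClosedCone s (k + 1) x)
    (hk : k + 1 ≤ s.card) {i : ι} (hi : i ∈ s) : ClosedCone (s.erase i) k x := by
  intro j hj
  have hc : ContinuousWithinAt (fun t : ℝ => esym (s.erase i) j (x + t • 1)) (Set.Ioi 0) 0 := by
    have := (continuous_esym (s.erase i) j).comp (show Continuous fun t : ℝ => x + t • 1 by fun_prop)
    exact this.continuousWithinAt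
  have := ge_of_tendsto hc (eventually_nhdsWithin_of_forall fun t ht =>
    ((h.openCone_add hk (Set.mem_Ioi.1 ht)).erase hi j hj).le)
  simpa using this

/-- On the closed Gårding cone `log S_k` is concave. -/
theorem ClosedCone.esym_mul_esymDeriv₂_le {s : Finset ι} {k : ℕ} {x : ι → ℝ}
    (h : ClosedCone s k x) (hk : k ≤ s.card) (y : ι → ℝ) :
    esym s k x * esymDeriv₂ s k x y ≤ esymDeriv s k x y ^ 2 := by
  have hl : Continuous fun t : ℝ => x + t • (1 : ι → ℝ) := by fun_prop
  have c1 := (continuous_esym s k).comp hl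
  have c2 : Continuous fun x : ι → ℝ => esymDeriv s k x y := by
    unfold esymDeriv
    exact continuous_finsetSum _ fun i _ => continuous_const.mul (continuous_esymPred _ _)
  have c3 : Continuous fun x : ι → ℝ => esymDeriv₂ s k x y := by
    unfold esymDeriv₂
    exact continuous_finsetSum _ fun i _ => continuous_finsetSum _ fun j _ =>
      continuous_const.mul (continuous_esymPred _ _)
  have hc : ContinuousWithinAt (fun t : ℝ => esymDeriv s k (x + t • 1) y ^ 2 -
      esym s k (x + t • 1) * esymDeriv₂ s k (x + t • 1) y) (Set.Ioi 0) 0 :=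
    (((c2.comp hl).pow 2).sub (c1.mul (c3.comp hl))).continuousWithinAt
  have := ge_of_tendsto hc (eventually_nhdsWithin_of_forall fun t ht => sub_nonneg.2
    ((h.openCone_add hk (Set.mem_Ioi.1 ht)).esym_mul_esymDeriv₂_le y))
  simpa using this

/-- The lower bound `S_{k-1;i} λ_i ≥ (k/n) S_k` for a largest entry `λ_i`. -/
theorem ClosedCone.mul_esym_le_card_mul {s : Finset ι} {m : ℕ} {x : ι → ℝ}
    (h : ClosedCone s (m + 1) x) (hk : m + 1 < s.card) {i : ι} (hi : i ∈ s)
    (hmax : ∀ j ∈ s, x j ≤ x i) :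
    ((m : ℝ) + 1) * esym s (m + 1) x ≤ s.card * (x i * esym (s.erase i) m x) := by
  have he := esym_erase hi m x
  have h0 := h (m + 1) le_rfl
  have hcard : (m : ℝ) + 1 < s.card := by exact_mod_cast hk
  -- If `S_k` of the erased family is not positive, `x i * S_{k-1;i}` alone already dominates `S_k`.
  rcases le_or_gt (esym (s.erase i) (m + 1) x) 0 with hneg | hpos
  · nlinarith
  have hc : ClosedCone (s.erase i) (m + 1) x := by
    intro j hj
    rcases Nat.lt_or_ge j (m + 1) with hj' | hj'
    · exact h.erase (by omega) hi j (by omega)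
    · obtain rfl : j = m + 1 := by omega
      exact hpos.le
  have hcd : (s.erase i).card = s.card - 1 := Finset.card_erase_of_mem hi
  have h1 := sum_mul_esym_erase (s.erase i) m x
  have h2 := sum_esym_erase (s.erase i) m x
  -- Otherwise the erased family lies in the cone of order `k`. Replacing each `x j` by the maximum
  -- `x i` in Euler's identity gives `k S_{k;i} ≤ (n - k) x i S_{k-1;i}`.
  have h3 : ∑ j ∈ s.erase i, x j * esym ((s.erase i).erase j) m x ≤
      ∑ j ∈ s.erase i, x i * esym ((s.erase i).erase j) m x :=
    Finset.sum_le_sum fun j hj => mul_le_mul_of_nonneg_right (hmax j (Finset.mem_of_mem_erase hj))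
      (hc.erase (by omega) hj m le_rfl)
  rw [h1, ← Finset.mul_sum, h2, hcd, Nat.cast_sub (by omega)] at h3
  push_cast at h3
  rw [he]
  nlinarith

end Concavity

/-! ### Second order expansion of sums of principal minors at a diagonal matrix -/

section Minors
variable {ι : Type*} [DecidableEq ι]

theorem hasDerivAt_prod_of_hasDerivAt (s : Finset ι) {m m₁ : ι → ℝ → ℂ}
    (h₁ : ∀ i t, HasDerivAt (m i) (m₁ i t) t) (t : ℝ) :
    HasDerivAt (fun t => ∏ i ∈ s, m i t) (∑ i ∈ s, m₁ i t * ∏ j ∈ s.erase i, m j t) t := by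
  convert! HasDerivAt.fun_finsetProd (u := s) (fun i _ => h₁ i t) using 1
  exact Finset.sum_congr rfl fun i _ => by rw [smul_eq_mul, mul_comm]

theorem hasDerivAt_sum_mul_prod (s : Finset ι) {m m₁ : ι → ℝ → ℂ} {m₂ : ι → ℂ} {t : ℝ}
    (h₁ : ∀ i t, HasDerivAt (m i) (m₁ i t) t) (h₂ : ∀ i, HasDerivAt (m₁ i) (m₂ i) t) :
    HasDerivAt (fun t => ∑ i ∈ s, m₁ i t * ∏ j ∈ s.erase i, m j t)
      (∑ i ∈ s, (m₂ i * ∏ j ∈ s.erase i, m j t +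
        m₁ i t * ∑ j ∈ s.erase i, m₁ j t * ∏ l ∈ (s.erase i).erase j, m l t)) t :=
  HasDerivAt.fun_sum fun i _ => (h₂ i).mul (hasDerivAt_prod_of_hasDerivAt (s.erase i) h₁ t)

theorem prod_diagonal_eq_zero {d : ι → ℂ} {σ : Equiv.Perm ι} {s : Finset ι} {i : ι} (hi : i ∈ s)
    (h : σ i ≠ i) : ∏ j ∈ s, Matrix.diagonal d (σ j) j = 0 :=
  Finset.prod_eq_zero hi (Matrix.diagonal_apply_ne _ h)

theorem sum_powersetCard_ite_erase (s : Finset ι) (k : ℕ) {i : ι} (hi : i ∈ s)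
    (F : Finset ι → ℂ) :
    ∑ I ∈ s.powersetCard (k + 1), (if i ∈ I then F (I.erase i) else 0) =
      ∑ J ∈ (s.erase i).powersetCard k, F J := by
  conv_lhs => rw [← Finset.insert_erase hi]
  have hn : ∀ m, ∀ J ∈ (s.erase i).powersetCard m, i ∉ J := fun m J hJ h =>
    Finset.notMem_erase i s ((Finset.mem_powersetCard.1 hJ).1 h)
  rw [Finset.powersetCard_succ_insert (Finset.notMem_erase i s), Finset.sum_union,
    Finset.sum_eq_zero, zero_add, Finset.sum_image]
  · refine Finset.sum_congr rfl fun J hJ => ?_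
    rw [if_pos (Finset.mem_insert_self i J), Finset.erase_insert (hn k J hJ)]
  · intro J hJ J' hJ' h
    rw [← Finset.erase_insert (hn k J hJ), ← Finset.erase_insert (hn k J' hJ'), h]
  · intro J hJ
    rw [if_neg (hn _ J hJ)]
  · rw [Finset.disjoint_left]
    intro J hJ hJ'
    obtain ⟨J', -, rfl⟩ := Finset.mem_image.1 hJ'
    exact hn _ _ hJ (Finset.mem_insert_self i J')

theorem sum_powersetCard_ite_prod (s : Finset ι) (k : ℕ) {i : ι} (hi : i ∈ s) (x : ι → ℂ) :
    ∑ I ∈ s.powersetCard k, (if i ∈ I then ∏ j ∈ I.erase i, x j else 0) =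
      esymPred (s.erase i) k x := by
  cases k with
  | zero => simp [esymPred_zero]
  | succ k => exact sum_powersetCard_ite_erase s k hi fun J => ∏ j ∈ J, x j

theorem sum_powersetCard_ite_ite_prod (s : Finset ι) (k : ℕ) {i j : ι} (hi : i ∈ s)
    (hj : j ∈ s.erase i) (x : ι → ℂ) :
    ∑ I ∈ s.powersetCard k, (if i ∈ I then
      (if j ∈ I then ∏ l ∈ (I.erase i).erase j, x l else 0) else 0) =
      esymPred ((s.erase i).erase j) (k - 1) x := by
  have hji := Finset.ne_of_mem_erase hj
  cases k with
  | zero => simp [esymPred_zero]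
  | succ k =>
    rw [Nat.add_sub_cancel, ← sum_powersetCard_ite_prod _ _ hj,
      ← sum_powersetCard_ite_erase s k hi]
    refine Finset.sum_congr rfl fun I _ => ?_
    simp [Finset.mem_erase, hji]

variable [Fintype ι]

/-- A permutation fixing every index but one is the identity, so only one term survives. -/
theorem sum_perm_mul_prod_diagonal_erase (d : ι → ℂ) (c : ι → ι → ℂ) (i : ι) :
    ∑ σ : Equiv.Perm ι, ((Equiv.Perm.sign σ : ℤ) : ℂ) *
      (c (σ i) i * ∏ j ∈ Finset.univ.erase i, Matrix.diagonal d (σ j) j) =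
      c i i * ∏ j ∈ Finset.univ.erase i, d j := by
  rw [Finset.sum_eq_single 1]
  · simp
  · intro σ _ hσ
    have : ∃ j, j ≠ i ∧ σ j ≠ j := by
      by_contra! hc
      apply hσ
      ext j
      by_cases hj : j = i
      · subst hj
        by_contra hne
        have h1 := hc (σ j) hne
        exact hne (σ.injective h1)
      · exact hc j hj
    obtain ⟨j, hj, hσj⟩ := this
    rw [prod_diagonal_eq_zero (Finset.mem_erase.2 ⟨hj, Finset.mem_univ j⟩) hσj]
    simp
  · simp

/-- Only the identity and the transposition of `i` and `j` fix every other index. The transposition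
produces the off-diagonal product. -/
theorem sum_perm_mul_prod_diagonal_erase_erase (d : ι → ℂ) (c : ι → ι → ℂ) {i j : ι}
    (hij : j ≠ i) :
    ∑ σ : Equiv.Perm ι, ((Equiv.Perm.sign σ : ℤ) : ℂ) *
      (c (σ i) i * (c (σ j) j *
        ∏ l ∈ (Finset.univ.erase i).erase j, Matrix.diagonal d (σ l) l)) =
      (c i i * c j j - c j i * c i j) * ∏ l ∈ (Finset.univ.erase i).erase j, d l := by
  have hne : (1 : Equiv.Perm ι) ≠ Equiv.swap i j := by
    intro h
    have := congrArg (fun σ : Equiv.Perm ι => σ i) h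
    simp at this
    exact hij this.symm
  rw [← Finset.sum_subset (Finset.subset_univ {1, Equiv.swap i j}), Finset.sum_pair hne]
  · have : ∏ l ∈ (Finset.univ.erase i).erase j, Matrix.diagonal d (Equiv.swap i j l) l =
        ∏ l ∈ (Finset.univ.erase i).erase j, d l := by
      refine Finset.prod_congr rfl fun l hl => ?_
      simp only [Finset.mem_erase, Finset.mem_univ, and_true] at hl
      rw [Equiv.swap_apply_of_ne_of_ne hl.2 hl.1, Matrix.diagonal_apply_eq]
    rw [this, Equiv.Perm.sign_swap hij.symm]
    simp
    ring
  · intro σ _ hσ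
    simp only [Finset.mem_insert, Finset.mem_singleton, not_or] at hσ
    have : ∃ l, l ≠ i ∧ l ≠ j ∧ σ l ≠ l := by
      by_contra! hc
      have hmem : ∀ l, (l = i ∨ l = j) → σ l = i ∨ σ l = j := by
        intro l hl
        by_contra! hcon
        have h1 := σ.injective (hc (σ l) hcon.1 hcon.2)
        rcases hl with rfl | rfl
        · exact hcon.1 h1
        · exact hcon.2 h1
      rcases hmem i (Or.inl rfl) with hi | hi
      · apply hσ.1
        ext l
        by_cases hl : l = i
        · subst hl; exact hi
        by_cases hl' : l = j
        · subst hl'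
          rcases hmem l (Or.inr rfl) with h | h
          · exact absurd (σ.injective (h.trans hi.symm)) hl
          · exact h
        · exact hc l hl hl'
      · apply hσ.2
        ext l
        by_cases hl : l = i
        · subst hl; rw [hi, Equiv.swap_apply_left]
        by_cases hl' : l = j
        · subst hl'
          rcases hmem l (Or.inr rfl) with h | h
          · rw [h, Equiv.swap_apply_right]
          · exact absurd (σ.injective (h.trans hi.symm)) hl
        · rw [hc l hl hl', Equiv.swap_apply_of_ne_of_ne hl hl']
    obtain ⟨l, hl, hl', hσl⟩ := this
    rw [prod_diagonal_eq_zero (i := l) (by simp [hl, hl']) hσl]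
    simp

theorem exists_hasDerivAt_det {M M₁ : ℝ → Matrix ι ι ℂ} {M₂ : Matrix ι ι ℂ} {d : ι → ℂ} {t₀ : ℝ}
    (h₁ : ∀ i j t, HasDerivAt (fun t => M t i j) (M₁ t i j) t)
    (h₂ : ∀ i j, HasDerivAt (fun t => M₁ t i j) (M₂ i j) t₀) (h₀ : M t₀ = Matrix.diagonal d) :
    ∃ D : ℝ → ℂ, (∀ t, HasDerivAt (fun t => (M t).det) (D t) t) ∧
      D t₀ = ∑ i, M₁ t₀ i i * ∏ j ∈ Finset.univ.erase i, d j ∧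
      HasDerivAt D (∑ i, M₂ i i * ∏ j ∈ Finset.univ.erase i, d j +
        ∑ i, ∑ j ∈ Finset.univ.erase i, (M₁ t₀ i i * M₁ t₀ j j - M₁ t₀ j i * M₁ t₀ i j) *
          ∏ l ∈ (Finset.univ.erase i).erase j, d l) t₀ := by
  refine ⟨fun t => ∑ σ : Equiv.Perm ι, ((Equiv.Perm.sign σ : ℤ) : ℂ) * ∑ i, M₁ t (σ i) i *
    ∏ j ∈ Finset.univ.erase i, M t (σ j) j, fun t => ?_, ?_, ?_⟩
  · simp only [Matrix.det_apply']
    exact HasDerivAt.fun_sum fun σ _ => (hasDerivAt_prod_of_hasDerivAt Finset.univ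
      (fun i t => h₁ (σ i) i t) t).const_mul _
  · simp only [Finset.mul_sum, h₀]
    rw [Finset.sum_comm]
    exact Finset.sum_congr rfl fun i _ => sum_perm_mul_prod_diagonal_erase d (M₁ t₀) i
  · have h := HasDerivAt.fun_sum fun (σ : Equiv.Perm ι) (_ : σ ∈ Finset.univ) =>
      (hasDerivAt_sum_mul_prod Finset.univ (fun i t => h₁ (σ i) i t)
        (fun i => h₂ (σ i) i)).const_mul ((Equiv.Perm.sign σ : ℤ) : ℂ)
    convert! h using 1
    simp only [Finset.sum_add_distrib, mul_add, Finset.mul_sum, h₀]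
    congr 1
    · rw [Finset.sum_comm]
      exact Finset.sum_congr rfl fun i _ => (sum_perm_mul_prod_diagonal_erase d M₂ i).symm
    · rw [Finset.sum_comm]
      refine Finset.sum_congr rfl fun i _ => ?_
      rw [Finset.sum_comm]
      refine Finset.sum_congr rfl fun j hj => ?_
      exact (sum_perm_mul_prod_diagonal_erase_erase d (M₁ t₀) (Finset.ne_of_mem_erase hj)).symm

/-- The sum of the principal minors of order `k`. -/
def minorSum (k : ℕ) (M : Matrix ι ι ℂ) : ℂ :=
  ∑ s ∈ Finset.univ.powersetCard k, (M.submatrix (Subtype.val : s → ι) (Subtype.val : s → ι)).det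

/-- Filling the rows outside `I` with rows of the identity keeps the index type fixed, so the
expansion of a full determinant applies to every principal minor. -/
theorem minorSum_eq_sum_piecewise (k : ℕ) (M : Matrix ι ι ℂ) :
    minorSum k M = ∑ I ∈ Finset.univ.powersetCard k,
      (Matrix.of fun i j => if i ∈ I then M i j else (1 : Matrix ι ι ℂ) i j).det := by
  refine Finset.sum_congr rfl fun I _ => ?_
  rw [← Matrix.det_piecewise_one_eq_submatrix_det]
  congr 1
  ext i j
  simp only [Matrix.of_apply, Finset.piecewise]
  split_ifs <;> rfl

theorem minorSum_diagonal (k : ℕ) (d : ι → ℂ) :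
    minorSum k (Matrix.diagonal d) = esym Finset.univ k d := by
  unfold minorSum esym
  refine Finset.sum_congr rfl fun I _ => ?_
  rw [Matrix.submatrix_diagonal _ _ Subtype.val_injective, Matrix.det_diagonal]
  exact Finset.prod_coe_sort I d

theorem exists_hasDerivAt_minorSum (k : ℕ) {M M₁ : ℝ → Matrix ι ι ℂ} {M₂ : Matrix ι ι ℂ}
    {d : ι → ℂ} {t₀ : ℝ} (h₁ : ∀ i j t, HasDerivAt (fun t => M t i j) (M₁ t i j) t)
    (h₂ : ∀ i j, HasDerivAt (fun t => M₁ t i j) (M₂ i j) t₀) (h₀ : M t₀ = Matrix.diagonal d) :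
    ∃ D : ℝ → ℂ, (∀ t, HasDerivAt (fun t => minorSum k (M t)) (D t) t) ∧
      D t₀ = ∑ i, M₁ t₀ i i * esymPred (Finset.univ.erase i) k d ∧
      HasDerivAt D (∑ i, M₂ i i * esymPred (Finset.univ.erase i) k d +
        ∑ i, ∑ j ∈ Finset.univ.erase i, (M₁ t₀ i i * M₁ t₀ j j - M₁ t₀ j i * M₁ t₀ i j) *
          esymPred ((Finset.univ.erase i).erase j) (k - 1) d) t₀ := by
  have key : ∀ I : Finset ι, ∃ D : ℝ → ℂ, (∀ t, HasDerivAt (fun t => (Matrix.of fun i j =>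
      if i ∈ I then M t i j else (1 : Matrix ι ι ℂ) i j).det) (D t) t) ∧
      D t₀ = ∑ i, M₁ t₀ i i * (if i ∈ I then ∏ j ∈ I.erase i, d j else 0) ∧
      HasDerivAt D (∑ i, M₂ i i * (if i ∈ I then ∏ j ∈ I.erase i, d j else 0) +
        ∑ i, ∑ j ∈ Finset.univ.erase i, (M₁ t₀ i i * M₁ t₀ j j - M₁ t₀ j i * M₁ t₀ i j) *
          (if i ∈ I then (if j ∈ I then ∏ l ∈ (I.erase i).erase j, d l else 0) else 0)) t₀ := by
    intro I
    obtain ⟨D, hD, hD0, hD1⟩ := exists_hasDerivAt_det (t₀ := t₀)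
      (M := fun t => Matrix.of fun i j => if i ∈ I then M t i j else (1 : Matrix ι ι ℂ) i j)
      (M₁ := fun t => Matrix.of fun i j => if i ∈ I then M₁ t i j else 0)
      (M₂ := Matrix.of fun i j => if i ∈ I then M₂ i j else 0)
      (d := fun i => if i ∈ I then d i else 1)
      (fun i j t => by
        by_cases hi : i ∈ I
        · simpa [hi] using h₁ i j t
        · simpa [hi] using hasDerivAt_const t _)
      (fun i j => by
        by_cases hi : i ∈ I
        · simpa [hi] using h₂ i j
        · simpa [hi] using hasDerivAt_const t₀ (0 : ℂ))
      (by
        ext i j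
        rw [h₀]
        by_cases hi : i ∈ I <;> by_cases hij : i = j <;> simp [hi, hij, Matrix.diagonal_apply,
          Matrix.one_apply])
    have p1 : ∀ i, ∏ j ∈ Finset.univ.erase i, (if j ∈ I then d j else 1) =
        ∏ j ∈ I.erase i, d j := by
      intro i
      rw [Finset.prod_ite_mem]
      congr 1
      ext j; simp
    have p2 : ∀ i j, ∏ l ∈ (Finset.univ.erase i).erase j, (if l ∈ I then d l else 1) =
        ∏ l ∈ (I.erase i).erase j, d l := by
      intro i j
      rw [Finset.prod_ite_mem]
      congr 1
      ext l; simp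
    refine ⟨D, hD, ?_, ?_⟩
    · rw [hD0]
      refine Finset.sum_congr rfl fun i _ => ?_
      rw [p1]
      by_cases hi : i ∈ I <;> simp [hi]
    · convert hD1 using 1
      congr 1
      · refine Finset.sum_congr rfl fun i _ => ?_
        rw [p1]
        by_cases hi : i ∈ I <;> simp [hi]
      · refine Finset.sum_congr rfl fun i _ => Finset.sum_congr rfl fun j _ => ?_
        rw [p2]
        by_cases hi : i ∈ I <;> by_cases hj : j ∈ I <;> simp [hi, hj]
  choose D hD hD0 hD1 using key
  refine ⟨fun t => ∑ I ∈ Finset.univ.powersetCard k, D I t, fun t => ?_, ?_, ?_⟩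
  · simp only [minorSum_eq_sum_piecewise]
    exact HasDerivAt.fun_sum fun I _ => hD I t
  · simp only [hD0]
    rw [Finset.sum_comm]
    refine Finset.sum_congr rfl fun i _ => ?_
    rw [← Finset.mul_sum, sum_powersetCard_ite_prod _ _ (Finset.mem_univ i)]
  · convert! HasDerivAt.fun_sum fun I (_ : I ∈ Finset.univ.powersetCard k) => hD1 I using 1
    rw [Finset.sum_add_distrib]
    congr 1
    · rw [Finset.sum_comm]
      refine Finset.sum_congr rfl fun i _ => ?_
      rw [← Finset.mul_sum, sum_powersetCard_ite_prod _ _ (Finset.mem_univ i)]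
    · rw [Finset.sum_comm]
      refine Finset.sum_congr rfl fun i _ => ?_
      rw [Finset.sum_comm]
      refine Finset.sum_congr rfl fun j hj => ?_
      rw [← Finset.mul_sum, sum_powersetCard_ite_ite_prod _ _ (Finset.mem_univ i) hj]

/-- Both sides are, up to the same sign, a coefficient of the characteristic polynomial. In this
form the operator can be differentiated without differentiating eigenvalues. -/
theorem esymm_roots_charpoly (k : ℕ) (hk : k ≤ Fintype.card ι) (M : Matrix ι ι ℂ) :
    M.charpoly.roots.esymm k = minorSum k M := by
  have hs : M.charpoly.Splits := IsAlgClosed.splits _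
  have h1 := Polynomial.coeff_eq_esymm_roots_of_card (p := M.charpoly)
    (Polynomial.splits_iff_card_roots.1 hs) (k := Fintype.card ι - k)
    (by rw [M.charpoly_natDegree_eq_dim]; omega)
  rw [M.charpoly_natDegree_eq_dim, M.charpoly_monic.leadingCoeff, one_mul, Nat.sub_sub_self hk,
    M.charpoly_coeff_eq_sum_minors k hk] at h1
  exact (mul_left_cancel₀ (pow_ne_zero k (by norm_num)) h1).symm

end Minors

/-! ### Concavity of the Hessian operator in Hermitian directions -/

theorem esymPred_ofReal {ι : Type*} (s : Finset ι) (k : ℕ) (x : ι → ℝ) :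
    esymPred s k (fun i => (x i : ℂ)) = ((esymPred s k x : ℝ) : ℂ) := by
  cases k with
  | zero => simp [esymPred_zero]
  | succ k => simp [esymPred_succ, esym]

section HermitianConcavity
variable {ι : Type*} [DecidableEq ι] [Fintype ι]

theorem ClosedCone.esymPred_erase_nonneg {m : ℕ} {x : ι → ℝ}
    (h : ClosedCone Finset.univ (m + 1) x) (hk : m + 1 ≤ Fintype.card ι) {i j : ι} (hij : j ≠ i) :
    0 ≤ esymPred ((Finset.univ.erase i).erase j) m x := by
  cases m with
  | zero => exact le_rfl
  | succ m =>
    have hc : (Finset.univ.erase i).card = Fintype.card ι - 1 :=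
      Finset.card_erase_of_mem (Finset.mem_univ i)
    exact (h.erase hk (Finset.mem_univ i)).erase (by omega) (by simp [hij]) m le_rfl

/-- Only the terms with `o` as one of the two indices are kept; by symmetry each of them occurs
twice. -/
theorem sum_sum_erase_ge {a : ι → ι → ℝ} (ha : ∀ i j, j ≠ i → 0 ≤ a i j)
    (hs : ∀ i j, a i j = a j i) (o : ι) :
    2 * ∑ i ∈ Finset.univ.erase o, a o i ≤ ∑ i, ∑ j ∈ Finset.univ.erase i, a i j := by
  rw [← Finset.add_sum_erase _ _ (Finset.mem_univ o), two_mul]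
  refine add_le_add le_rfl (Finset.sum_le_sum fun i hi => ?_)
  have hio := Finset.ne_of_mem_erase hi
  rw [hs]
  exact Finset.single_le_sum (f := fun j => a i j)
    (fun j hj => ha i j (Finset.ne_of_mem_erase hj)) (by simp [hio.symm])

/-- The diagonal entries of `X` contribute the second derivative of `S_k`, bounded by log-concavity.
For Hermitian `X` the off-diagonal products are `|X i j|^2` and enter with a favourable sign. Of
these, the row of `o` is retained to control third derivatives of `u`. -/
theorem ClosedCone.second_derivative_le {m : ℕ} {x : ι → ℝ} (h : ClosedCone Finset.univ (m + 1) x)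
    (hk : m + 1 ≤ Fintype.card ι) (hpos : 0 < esym Finset.univ (m + 1) x) {X : ι → ι → ℂ}
    (hX : ∀ i j, X j i = (starRingEnd ℂ) (X i j)) (Y : ι → ℂ) (o : ι) {f₁ f₂ : ℝ}
    (h₁ : f₁ = (∑ i, X i i * esymPred (Finset.univ.erase i) (m + 1) (fun i => (x i : ℂ))).re)
    (h₂ : f₂ = (∑ i, Y i * esymPred (Finset.univ.erase i) (m + 1) (fun i => (x i : ℂ)) +
      ∑ i, ∑ j ∈ Finset.univ.erase i, (X i i * X j j - X j i * X i j) *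
        esymPred ((Finset.univ.erase i).erase j) (m + 1 - 1) (fun i => (x i : ℂ))).re) :
    f₂ - f₁ ^ 2 / esym Finset.univ (m + 1) x +
      2 * ∑ i ∈ Finset.univ.erase o,
        esymPred ((Finset.univ.erase o).erase i) m x * ‖X i o‖ ^ 2 ≤
      ∑ i, (Y i).re * esym (Finset.univ.erase i) m x := by
  have hre : ∀ i, X i i = ((X i i).re : ℂ) := fun i =>
    (Complex.conj_eq_iff_real.1 (hX i i).symm).elim fun r hr => by rw [hr]; simp
  have e1 : f₁ = esymDeriv Finset.univ (m + 1) x fun i => (X i i).re := by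
    rw [h₁, esymDeriv, Complex.re_sum]
    refine Finset.sum_congr rfl fun i _ => ?_
    rw [esymPred_ofReal, Complex.re_mul_ofReal]
  have e2 : f₂ = ∑ i, (Y i).re * esym (Finset.univ.erase i) m x +
      (esymDeriv₂ Finset.univ (m + 1) x (fun i => (X i i).re) -
      ∑ i, ∑ j ∈ Finset.univ.erase i,
        esymPred ((Finset.univ.erase i).erase j) m x * ‖X j i‖ ^ 2) := by
    rw [h₂, Complex.add_re, Complex.re_sum, Complex.re_sum, esymDeriv₂,
      ← Finset.sum_sub_distrib]
    congr 1
    · refine Finset.sum_congr rfl fun i _ => ?_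
      rw [esymPred_ofReal, Complex.re_mul_ofReal, esymPred_succ]
    · refine Finset.sum_congr rfl fun i _ => ?_
      rw [Complex.re_sum, ← Finset.sum_sub_distrib]
      refine Finset.sum_congr rfl fun j _ => ?_
      rw [esymPred_ofReal, Complex.re_mul_ofReal, hX j i, hre i, hre j, Complex.mul_conj']
      simp only [Nat.add_sub_cancel, Complex.sub_re, ← Complex.ofReal_mul, ← Complex.ofReal_pow,
        Complex.ofReal_re]
      ring
  have hc := h.esym_mul_esymDeriv₂_le (by simpa using hk) fun i => (X i i).re
  have hd : esymDeriv₂ Finset.univ (m + 1) x (fun i => (X i i).re) ≤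
      f₁ ^ 2 / esym Finset.univ (m + 1) x := by
    rw [le_div_iff₀ hpos, e1]
    linarith
  have hs := sum_sum_erase_ge
    (a := fun i j => esymPred ((Finset.univ.erase i).erase j) m x * ‖X j i‖ ^ 2)
    (fun i j hij => mul_nonneg (h.esymPred_erase_nonneg hk hij) (sq_nonneg _))
    (fun i j => by
      rw [Finset.erase_right_comm, hX i j, RCLike.norm_conj]) o
  rw [e2]
  linarith

end HermitianConcavity

/-! ### Directional derivatives and the complex Hessian form -/

section Directional
variable {E : Type*} [NormedAddCommGroup E] [NormedSpace ℝ E]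

/-- The derivative of `g` in the direction `d`. -/
noncomputable def dirDeriv (d : E) (g : E → ℝ) (z : E) : ℝ := fderiv ℝ g z d

theorem ContDiff.dirDeriv {g : E → ℝ} (hg : ContDiff ℝ ∞ g) (d : E) :
    ContDiff ℝ ∞ (dirDeriv d g) := by
  unfold _root_.dirDeriv
  exact (hg.fderiv_right (m := ∞) (by simp)).clm_apply contDiff_const

theorem hasDerivAt_line {g : E → ℝ} (hg : ContDiff ℝ ∞ g) (z d : E) (t : ℝ) :
    HasDerivAt (fun t : ℝ => g (z + t • d)) (dirDeriv d g (z + t • d)) t := by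
  have h1 : HasDerivAt (fun t : ℝ => z + t • d) d t := by
    simpa using ((hasDerivAt_id t).smul_const d).const_add z
  exact ((hg.differentiable (by simp)) (z + t • d)).hasFDerivAt.comp_hasDerivAt t h1

theorem dirDeriv_dirDeriv {g : E → ℝ} (hg : ContDiff ℝ ∞ g) (d e : E) (z : E) :
    dirDeriv d (dirDeriv e g) z = fderiv ℝ (fderiv ℝ g) z d e := by
  unfold dirDeriv
  have h : DifferentiableAt ℝ (fderiv ℝ g) z :=
    (hg.fderiv_right (m := ∞) (by simp)).differentiable (by simp) z
  rw [fderiv_clm_apply h (differentiableAt_const e)]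
  simp

theorem dirDeriv_comm {g : E → ℝ} (hg : ContDiff ℝ ∞ g) (d e : E) :
    dirDeriv d (dirDeriv e g) = dirDeriv e (dirDeriv d g) := by
  ext z
  rw [dirDeriv_dirDeriv hg, dirDeriv_dirDeriv hg]
  exact (hg.contDiffAt.isSymmSndFDerivAt (by simpa using WithTop.coe_le_coe.2 (le_top : (2 : ℕ∞) ≤ ⊤))) d e

theorem dirDeriv_add {g h : E → ℝ} (hg : ContDiff ℝ ∞ g) (hh : ContDiff ℝ ∞ h) (d : E) :
    dirDeriv d (fun z => g z + h z) = fun z => dirDeriv d g z + dirDeriv d h z := by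
  ext z
  unfold dirDeriv
  rw [fderiv_fun_add (hg.differentiable (by simp) z) (hh.differentiable (by simp) z)]
  rfl

theorem dirDeriv_const_mul {g : E → ℝ} (hg : ContDiff ℝ ∞ g) (c : ℝ) (d : E) :
    dirDeriv d (fun z => c * g z) = fun z => c * dirDeriv d g z := by
  ext z
  unfold dirDeriv
  rw [fderiv_const_mul (hg.differentiable (by simp) z)]
  rfl

end Directional

namespace ExteriorHessian
variable {n : ℕ}

/-- The sesquilinear form `∂_x ∂̄_y g`. -/
noncomputable def hessForm (g : Cn n → ℝ) (z x y : Cn n) : ℂ :=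
  1 / 4 * (((dirDeriv x (dirDeriv y g) z + dirDeriv (Complex.I • x) (dirDeriv (Complex.I • y) g) z :
    ℝ) : ℂ) + Complex.I * ((dirDeriv x (dirDeriv (Complex.I • y) g) z -
      dirDeriv (Complex.I • x) (dirDeriv y g) z : ℝ) : ℂ))

/-- The real Levi form `∂_x ∂̄_x g`. -/
noncomputable def leviForm (g : Cn n → ℝ) (x z : Cn n) : ℝ :=
  1 / 4 * (dirDeriv x (dirDeriv x g) z +
    dirDeriv (Complex.I • x) (dirDeriv (Complex.I • x) g) z)

theorem contDiff_leviForm {g : Cn n → ℝ} (hg : ContDiff ℝ ∞ g) (x : Cn n) :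
    ContDiff ℝ ∞ (leviForm g x) :=
  contDiff_const.mul (((hg.dirDeriv x).dirDeriv x).add
    ((hg.dirDeriv (Complex.I • x)).dirDeriv (Complex.I • x)))

theorem hessForm_self {g : Cn n → ℝ} (hg : ContDiff ℝ ∞ g) (z x : Cn n) :
    hessForm g z x x = leviForm g x z := by
  unfold hessForm leviForm
  rw [dirDeriv_comm hg x (Complex.I • x)]
  push_cast
  ring

theorem hessForm_conj {g : Cn n → ℝ} (hg : ContDiff ℝ ∞ g) (z x y : Cn n) :
    hessForm g z y x = (starRingEnd ℂ) (hessForm g z x y) := by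
  unfold hessForm
  rw [dirDeriv_comm hg y x, dirDeriv_comm hg (Complex.I • y) (Complex.I • x),
    dirDeriv_comm hg y (Complex.I • x), dirDeriv_comm hg (Complex.I • y) x]
  simp only [map_mul, map_add, map_div₀, Complex.conj_ofReal, Complex.conj_I, map_one, map_ofNat]
  push_cast
  ring

theorem I_smul_I_smul (x : Cn n) : Complex.I • Complex.I • x = -x := by
  rw [smul_smul, Complex.I_mul_I, neg_one_smul]

theorem smul_eq_re_smul_add (c : ℂ) (x : Cn n) : c • x = c.re • x + c.im • Complex.I • x := by
  ext i
  simp only [PiLp.smul_apply, PiLp.add_apply, smul_eq_mul, Complex.real_smul]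
  conv_lhs => rw [← Complex.re_add_im c]
  ring

theorem I_smul_smul_eq (c : ℂ) (x : Cn n) :
    Complex.I • c • x = c.re • Complex.I • x - c.im • x := by
  rw [smul_comm, smul_eq_re_smul_add c, I_smul_I_smul, smul_neg, sub_eq_add_neg]

theorem hessForm_add_left {g : Cn n → ℝ} (hg : ContDiff ℝ ∞ g) (z x x' y : Cn n) :
    hessForm g z (x + x') y = hessForm g z x y + hessForm g z x' y := by
  unfold hessForm
  simp only [dirDeriv_dirDeriv hg, smul_add, map_add, add_apply]
  push_cast
  ring

theorem hessForm_smul_left {g : Cn n → ℝ} (hg : ContDiff ℝ ∞ g) (z : Cn n) (c : ℂ) (x y : Cn n) :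
    hessForm g z (c • x) y = c * hessForm g z x y := by
  unfold hessForm
  simp only [dirDeriv_dirDeriv hg, I_smul_smul_eq]
  rw [smul_eq_re_smul_add c x]
  simp only [map_add, map_sub, map_smul, add_apply,
    sub_apply, smul_apply, smul_eq_mul]
  conv_rhs => rw [← Complex.re_add_im c]
  push_cast
  linear_combination (-(1 / 4 : ℂ)) * (c.im : ℂ) * (((fderiv ℝ (fderiv ℝ g) z x)
    (Complex.I • y) : ℝ) - ((fderiv ℝ (fderiv ℝ g) z (Complex.I • x)) y : ℝ) : ℂ) *
      Complex.I_mul_I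

theorem hessForm_sum_left {g : Cn n → ℝ} (hg : ContDiff ℝ ∞ g) (z y : Cn n) {ι : Type*}
    (s : Finset ι) (c : ι → ℂ) (x : ι → Cn n) :
    hessForm g z (∑ i ∈ s, c i • x i) y = ∑ i ∈ s, c i * hessForm g z (x i) y := by
  let L : Cn n →ₗ[ℂ] ℂ :=
    { toFun := fun x => hessForm g z x y
      map_add' := fun a b => hessForm_add_left hg z a b y
      map_smul' := fun c a => hessForm_smul_left hg z c a y }
  have := map_sum L (fun i => c i • x i) s
  simp only [map_smul, smul_eq_mul] at this
  exact this

theorem hessForm_sum_right {g : Cn n → ℝ} (hg : ContDiff ℝ ∞ g) (z x : Cn n) {ι : Type*}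
    (s : Finset ι) (c : ι → ℂ) (y : ι → Cn n) :
    hessForm g z x (∑ i ∈ s, c i • y i) =
      ∑ i ∈ s, (starRingEnd ℂ) (c i) * hessForm g z x (y i) := by
  rw [hessForm_conj hg, hessForm_sum_left hg, map_sum]
  refine Finset.sum_congr rfl fun i _ => ?_
  rw [map_mul, ← hessForm_conj hg]

theorem fderiv_toC {g : Cn n → ℝ} (hg : ContDiff ℝ ∞ g) (z d : Cn n) :
    fderiv ℝ (toC g) z d = (dirDeriv d g z : ℂ) := by
  have h := (hg.differentiable (by simp) z).hasFDerivAt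
  have h2 : HasFDerivAt (toC g) (Complex.ofRealCLM.comp (fderiv ℝ g z)) z :=
    Complex.ofRealCLM.hasFDerivAt.comp z h
  rw [h2.fderiv]
  rfl

theorem dzbar_toC {g : Cn n → ℝ} (hg : ContDiff ℝ ∞ g) (j : Fin n) (z : Cn n) :
    dzbar j (toC g) z = (1 / 2) * (toC (dirDeriv (unitVec j) g) z +
      Complex.I * toC (dirDeriv (Complex.I • unitVec j) g) z) := by
  unfold dzbar
  rw [fderiv_toC hg, fderiv_toC hg]
  rfl

theorem cHess_eq_hessForm {g : Cn n → ℝ} (hg : ContDiff ℝ ∞ g) (z : Cn n) (i j : Fin n) :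
    cHess g z i j = hessForm g z (unitVec i) (unitVec j) := by
  have hd : ∀ d : Cn n, Differentiable ℝ (toC (dirDeriv d g)) := fun d =>
    Complex.ofRealCLM.differentiable.comp ((hg.dirDeriv d).differentiable (by simp))
  have key : ∀ d : Cn n, fderiv ℝ (fun w => dzbar j (toC g) w) z d =
      (1 / 2) * ((dirDeriv d (dirDeriv (unitVec j) g) z : ℂ) +
        Complex.I * dirDeriv d (dirDeriv (Complex.I • unitVec j) g) z) := by
    intro d
    have e : (fun w => dzbar j (toC g) w) = fun w => (1 / 2 : ℂ) *
        (toC (dirDeriv (unitVec j) g) w +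
          Complex.I * toC (dirDeriv (Complex.I • unitVec j) g) w) :=
      funext fun w => dzbar_toC hg j w
    rw [e, fderiv_const_mul (((hd _).fun_add ((hd _).const_mul _)) z),
      fderiv_fun_add ((hd _) z) ((hd _).const_mul _ z), fderiv_const_mul (hd _ z)]
    simp only [smul_apply, add_apply, smul_eq_mul]
    rw [fderiv_toC (hg.dirDeriv _), fderiv_toC (hg.dirDeriv _)]
  unfold cHess dz
  rw [Matrix.of_apply, key, key]
  unfold hessForm
  push_cast
  linear_combination (-(1 / 4 : ℂ)) * (dirDeriv (Complex.I • unitVec i)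
    (dirDeriv (Complex.I • unitVec j) g) z : ℂ) * Complex.I_mul_I

theorem sum_smul_unitVec (ξ : Cn n) : ∑ i, ξ i • (unitVec i : Cn n) = ξ := by
  ext j
  simp [unitVec, Finset.sum_apply, Pi.single_apply]

theorem levi_eq_leviForm {g : Cn n → ℝ} (hg : ContDiff ℝ ∞ g) (z ξ : Cn n) :
    levi g z ξ = leviForm g ξ z := by
  have h : hessForm g z ξ ξ = ∑ i, ∑ j, cHess g z i j * ξ i * (starRingEnd ℂ) (ξ j) := by
    conv_lhs => rw [← sum_smul_unitVec ξ]
    rw [hessForm_sum_left hg]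
    refine Finset.sum_congr rfl fun i _ => ?_
    rw [hessForm_sum_right hg, Finset.mul_sum]
    refine Finset.sum_congr rfl fun j _ => ?_
    rw [cHess_eq_hessForm hg]
    ring
  unfold levi
  rw [← h, hessForm_self hg, Complex.ofReal_re]

/-- The map `ℓ x - I * ℓ (I • x)` is complex linear, and the sum of its squared moduli over any
unitary frame is the squared norm of its Riesz vector. -/
theorem sum_sq_add_sq_orthonormalBasis (ℓ : Cn n →L[ℝ] ℝ) (e : OrthonormalBasis (Fin n) ℂ (Cn n)) :
    ∑ i, (ℓ (e i) ^ 2 + ℓ (Complex.I • e i) ^ 2) =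
      ∑ i : Fin n, (ℓ (unitVec i) ^ 2 + ℓ (Complex.I • unitVec i) ^ 2) := by
  let F : Cn n →ₗ[ℂ] ℂ :=
    { toFun := fun x => (ℓ x : ℂ) - Complex.I * ℓ (Complex.I • x)
      map_add' := fun x y => by simp only [smul_add, map_add]; push_cast; ring
      map_smul' := fun c x => by
        rw [I_smul_smul_eq, smul_eq_re_smul_add c x]
        simp only [map_add, map_sub, map_smul, smul_eq_mul, RingHom.id_apply]
        conv_rhs => rw [← Complex.re_add_im c]
        push_cast
        linear_combination (c.im : ℂ) * (ℓ (Complex.I • x)) * Complex.I_mul_I }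
  have hF : ∀ x, ℓ x ^ 2 + ℓ (Complex.I • x) ^ 2 = ‖F x‖ ^ 2 := fun x => by
    have : F x = ⟨ℓ x, -ℓ (Complex.I • x)⟩ := by
      apply Complex.ext <;> simp [F]
    rw [this, ← Complex.normSq_eq_norm_sq, Complex.normSq_mk]
    ring
  have hb : ∀ b : OrthonormalBasis (Fin n) ℂ (Cn n), ∑ i, ‖F (b i)‖ ^ 2 =
      ‖(InnerProductSpace.toDual ℂ (Cn n)).symm F.toContinuousLinearMap‖ ^ 2 := fun b => by
    rw [← b.sum_sq_norm_inner_left]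
    refine Finset.sum_congr rfl fun i _ => ?_
    rw [InnerProductSpace.toDual_symm_apply]
    rfl
  simp only [hF]
  rw [hb e, ← hb (EuclideanSpace.basisFun (Fin n) ℂ)]
  simp [unitVec]

theorem gradSq_eq_sum {g : Cn n → ℝ} (hg : ContDiff ℝ ∞ g)
    (e : OrthonormalBasis (Fin n) ℂ (Cn n)) (z : Cn n) :
    gradSq g z = 1 / 4 * ∑ i, (dirDeriv (e i) g z ^ 2 + dirDeriv (Complex.I • e i) g z ^ 2) := by
  unfold dirDeriv
  rw [sum_sq_add_sq_orthonormalBasis, Finset.mul_sum]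
  unfold gradSq
  refine Finset.sum_congr rfl fun i _ => ?_
  unfold dz
  rw [fderiv_toC hg, fderiv_toC hg]
  have : (1 / 2 : ℂ) * ((dirDeriv (unitVec i) g z : ℂ) -
      Complex.I * (dirDeriv (Complex.I • unitVec i) g z : ℂ)) =
      ⟨1 / 2 * dirDeriv (unitVec i) g z, -(1 / 2 * dirDeriv (Complex.I • unitVec i) g z)⟩ := by
    apply Complex.ext <;> simp
  rw [this, ← Complex.normSq_eq_norm_sq, Complex.normSq_mk]
  unfold dirDeriv
  ring

theorem isHermitian_cHess {g : Cn n → ℝ} (hg : ContDiff ℝ ∞ g) (z : Cn n) :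
    (cHess g z).IsHermitian := by
  ext i j
  rw [Matrix.conjTranspose_apply, cHess_eq_hessForm hg, cHess_eq_hessForm hg, hessForm_conj hg,
    RCLike.star_def, Complex.conj_conj]

/-- The complex Hessian in an orthonormal basis. -/
noncomputable def hessMat (e : OrthonormalBasis (Fin n) ℂ (Cn n)) (g : Cn n → ℝ) (z : Cn n) :
    Matrix (Fin n) (Fin n) ℂ :=
  Matrix.of fun i j => hessForm g z (e i) (e j)

theorem hessMat_eq_mul {g : Cn n → ℝ} (hg : ContDiff ℝ ∞ g) (z : Cn n)
    (e : OrthonormalBasis (Fin n) ℂ (Cn n)) :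
    hessMat e g z = (Matrix.of fun p i => e p i) * cHess g z *
      (Matrix.of fun j q => (starRingEnd ℂ) (e q j)) := by
  ext p q
  rw [hessMat, Matrix.of_apply]
  conv_lhs => rw [← sum_smul_unitVec (e p), ← sum_smul_unitVec (e q)]
  rw [hessForm_sum_right hg, Matrix.mul_apply]
  refine Finset.sum_congr rfl fun j _ => ?_
  rw [hessForm_sum_left hg, Matrix.mul_apply, mul_comm, Finset.sum_mul, Finset.sum_mul]
  refine Finset.sum_congr rfl fun i _ => ?_
  rw [cHess_eq_hessForm hg]
  simp

theorem orthonormalBasis_mul_conj (e : OrthonormalBasis (Fin n) ℂ (Cn n)) :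
    (Matrix.of fun p i => e p i) * (Matrix.of fun j q => (starRingEnd ℂ) (e q j)) =
      (1 : Matrix (Fin n) (Fin n) ℂ) := by
  ext p q
  have h := orthonormal_iff_ite.1 e.orthonormal q p
  rw [PiLp.inner_apply] at h
  simp only [RCLike.inner_apply] at h
  rw [Matrix.mul_apply, Matrix.one_apply]
  simp only [Matrix.of_apply, h, eq_comm (a := q)]

theorem charpoly_hessMat {g : Cn n → ℝ} (hg : ContDiff ℝ ∞ g) (z : Cn n)
    (e : OrthonormalBasis (Fin n) ℂ (Cn n)) :
    (hessMat e g z).charpoly = (cHess g z).charpoly := by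
  have h := mul_eq_one_comm.1 (orthonormalBasis_mul_conj e)
  rw [hessMat_eq_mul hg, mul_assoc, Matrix.charpoly_mul_comm, mul_assoc, h, mul_one]

theorem hessOp_eq_minorSum {g : Cn n → ℝ} (hg : ContDiff ℝ ∞ g) (z : Cn n)
    (e : OrthonormalBasis (Fin n) ℂ (Cn n)) {k : ℕ} (hk : k ≤ n) :
    hessOp k g z = (minorSum k (hessMat e g z)).re := by
  unfold hessOp
  rw [← charpoly_hessMat hg z e, esymm_roots_charpoly k (by simpa using hk)]

theorem exists_hessMat_eq_diagonal {g : Cn n → ℝ} (hg : ContDiff ℝ ∞ g) (z : Cn n) :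
    ∃ (e : OrthonormalBasis (Fin n) ℂ (Cn n)) (x : Fin n → ℝ),
      hessMat e g z = Matrix.diagonal fun i => (x i : ℂ) := by
  -- The form is linear in the first index, so frame vectors multiply the matrix as rows, and the
  -- eigenvectors of the transpose are the ones needed.
  have hA := (isHermitian_cHess hg z).transpose
  refine ⟨hA.eigenvectorBasis, hA.eigenvalues, ?_⟩
  have h1 : (Matrix.of fun p i => hA.eigenvectorBasis p i) * cHess g z =
      Matrix.diagonal (fun i => (hA.eigenvalues i : ℂ)) *
        (Matrix.of fun p i => hA.eigenvectorBasis p i) := by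
    ext p i
    have := congrFun (hA.mulVec_eigenvectorBasis p) i
    rw [Matrix.mulVec_transpose] at this
    rw [Matrix.diagonal_mul]
    simpa [Matrix.mul_apply, Matrix.vecMul, dotProduct] using this
  rw [hessMat_eq_mul hg, h1, mul_assoc, orthonormalBasis_mul_conj, mul_one]

theorem hasDerivAt_hessForm {g : Cn n → ℝ} (hg : ContDiff ℝ ∞ g) (z d x y : Cn n) (t : ℝ) :
    HasDerivAt (fun t : ℝ => hessForm g (z + t • d) x y)
      (hessForm (dirDeriv d g) (z + t • d) x y) t := by
  have h : ∀ a b : Cn n, HasDerivAt (fun t : ℝ => dirDeriv a (dirDeriv b g) (z + t • d))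
      (dirDeriv a (dirDeriv b (dirDeriv d g)) (z + t • d)) t := fun a b => by
    have := hasDerivAt_line ((hg.dirDeriv b).dirDeriv a) z d t
    rwa [dirDeriv_comm (hg.dirDeriv b) d a, dirDeriv_comm hg d b] at this
  exact (((h _ _).add (h _ _)).ofReal_comp.add
    (((h _ _).sub (h _ _)).ofReal_comp.const_mul _)).const_mul _

/-- The Hessian equation differentiated once and twice in a direction `d`. -/
theorem differentiated_equation {u f : Cn n → ℝ} (hu : ContDiff ℝ ∞ u) (hf : ContDiff ℝ ∞ f)
    {z : Cn n} {m : ℕ} (hm : m + 1 ≤ n) (heq : ∀ᶠ w in 𝓝 z, hessOp (m + 1) u w = f w)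
    (hpos : 0 < f z) {e : OrthonormalBasis (Fin n) ℂ (Cn n)} {x : Fin n → ℝ}
    (hdiag : hessMat e u z = Matrix.diagonal fun i => (x i : ℂ))
    (hcone : ClosedCone Finset.univ (m + 1) x) (o : Fin n) (d : Cn n) :
    dirDeriv d f z = ∑ i, leviForm (dirDeriv d u) (e i) z * esym (Finset.univ.erase i) m x ∧
    dirDeriv d (dirDeriv d f) z - dirDeriv d f z ^ 2 / f z +
      2 * ∑ i ∈ Finset.univ.erase o, esymPred ((Finset.univ.erase o).erase i) m x *
        ‖hessForm (dirDeriv d u) z (e i) (e o)‖ ^ 2 ≤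
      ∑ i, leviForm (dirDeriv d (dirDeriv d u)) (e i) z * esym (Finset.univ.erase i) m x := by
  have hud := hu.dirDeriv d
  have hudd := hud.dirDeriv d
  obtain ⟨D, hD, hD0, hD1⟩ := exists_hasDerivAt_minorSum (m + 1) (t₀ := (0 : ℝ))
    (M := fun t : ℝ => hessMat e u (z + t • d))
    (M₁ := fun t : ℝ => hessMat e (dirDeriv d u) (z + t • d))
    (M₂ := hessMat e (dirDeriv d (dirDeriv d u)) z)
    (d := fun i => (x i : ℂ))
    (fun i j t => hasDerivAt_hessForm hu z d (e i) (e j) t)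
    (fun i j => by
      simpa [hessMat] using hasDerivAt_hessForm hud z d (e i) (e j) 0)
    (by simpa using hdiag)
  have hre : ∀ {φ : ℝ → ℂ} {φ' : ℂ} {t : ℝ}, HasDerivAt φ φ' t →
      HasDerivAt (fun t => (φ t).re) φ'.re t := fun h =>
    Complex.reCLM.hasFDerivAt.comp_hasDerivAt _ h
  have hline : Filter.Tendsto (fun t : ℝ => z + t • d) (𝓝 0) (𝓝 z) := by
    have : ContinuousAt (fun t : ℝ => z + t • d) 0 := by fun_prop
    simpa [ContinuousAt] using this
  -- Equality of the two sides near `0`, not only at `0`, lets their first and second derivatives be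
  -- identified.
  have hev : (fun t : ℝ => (minorSum (m + 1) (hessMat e u (z + t • d))).re) =ᶠ[𝓝 0]
      fun t : ℝ => f (z + t • d) := by
    filter_upwards [hline.eventually heq] with t ht
    rw [← ht, hessOp_eq_minorSum hu _ e hm]
  have hev1 : (fun t => (D t).re) =ᶠ[𝓝 0] fun t : ℝ => dirDeriv d f (z + t • d) := by
    filter_upwards [hev.eventuallyEq_nhds] with t ht
    exact (hre (hD t)).unique ((hasDerivAt_line hf z d t).congr_of_eventuallyEq ht)
  have h1 := hev1.self_of_nhds
  have h2 := (hre hD1).unique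
    ((hasDerivAt_line (hf.dirDeriv d) z d 0).congr_of_eventuallyEq hev1)
  simp only [zero_smul, add_zero] at h1 h2
  rw [hD0] at h1
  simp only [zero_smul, add_zero] at h1 h2
  have hfz : f z = esym Finset.univ (m + 1) x := by
    rw [← heq.self_of_nhds, hessOp_eq_minorSum hu _ e hm, hdiag, minorSum_diagonal]
    simp [esym, ← Complex.ofReal_prod, ← Complex.ofReal_sum]
  constructor
  · rw [← h1, Complex.re_sum]
    refine Finset.sum_congr rfl fun i _ => ?_
    rw [esymPred_ofReal, Complex.re_mul_ofReal, esymPred_succ, hessMat, Matrix.of_apply,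
      hessForm_self hud, Complex.ofReal_re]
  · have := hcone.second_derivative_le (by simpa using hm) (hfz ▸ hpos)
      (X := fun i j => hessForm (dirDeriv d u) z (e i) (e j))
      (fun i j => hessForm_conj hud z _ _)
      (fun i => hessForm (dirDeriv d (dirDeriv d u)) z (e i) (e i)) o h1.symm h2.symm
    rw [← hfz] at this
    simpa only [hessForm_self hudd, Complex.ofReal_re] using this

/-- Symmetry of third derivatives, `∂_x u_{y ȳ} = ∂_y u_{x ȳ}`: the right hand terms, combined with
the factor `-I`, give the complex gradient of the Levi form in the direction `x`. They are the
quantities that differentiating the equation along `y` and `I • y` controls. -/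
theorem sq_add_sq_le_hessForm {u : Cn n → ℝ} (hu : ContDiff ℝ ∞ u) (z x y : Cn n) :
    dirDeriv x (leviForm u y) z ^ 2 + dirDeriv (Complex.I • x) (leviForm u y) z ^ 2 ≤
      2 * (‖hessForm (dirDeriv y u) z x y‖ ^ 2 +
        ‖hessForm (dirDeriv (Complex.I • y) u) z x y‖ ^ 2) := by
  have hD : ∀ d, dirDeriv d (leviForm u y) z = 1 / 4 * (dirDeriv d (dirDeriv y (dirDeriv y u)) z +
      dirDeriv d (dirDeriv (Complex.I • y) (dirDeriv (Complex.I • y) u)) z) := fun d => by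
    have hy := (hu.dirDeriv y).dirDeriv y
    have hy' := (hu.dirDeriv (Complex.I • y)).dirDeriv (Complex.I • y)
    unfold leviForm
    rw [dirDeriv_const_mul (hy.add hy'), dirDeriv_add hy hy']
  have key : hessForm (dirDeriv y u) z x y -
      Complex.I * hessForm (dirDeriv (Complex.I • y) u) z x y =
      ⟨dirDeriv x (leviForm u y) z, -dirDeriv (Complex.I • x) (leviForm u y) z⟩ := by
    unfold hessForm
    rw [dirDeriv_comm hu y (Complex.I • y), hD, hD]
    apply Complex.ext <;> simp <;> ring
  have h1 : ‖hessForm (dirDeriv y u) z x y -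
      Complex.I * hessForm (dirDeriv (Complex.I • y) u) z x y‖ ^ 2 =
      dirDeriv x (leviForm u y) z ^ 2 + dirDeriv (Complex.I • x) (leviForm u y) z ^ 2 := by
    rw [key, ← Complex.normSq_eq_norm_sq, Complex.normSq_mk]
    ring
  rw [← h1]
  have h2 := norm_sub_le (hessForm (dirDeriv y u) z x y)
    (Complex.I * hessForm (dirDeriv (Complex.I • y) u) z x y)
  rw [norm_mul, Complex.norm_I, one_mul] at h2
  have h3 := norm_nonneg (hessForm (dirDeriv y u) z x y -
    Complex.I * hessForm (dirDeriv (Complex.I • y) u) z x y)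
  nlinarith [sq_nonneg (‖hessForm (dirDeriv y u) z x y‖ -
    ‖hessForm (dirDeriv (Complex.I • y) u) z x y‖)]

theorem leviForm_leviForm_comm {u : Cn n → ℝ} (hu : ContDiff ℝ ∞ u) (z x y : Cn n) :
    leviForm (dirDeriv y (dirDeriv y u)) x z +
      leviForm (dirDeriv (Complex.I • y) (dirDeriv (Complex.I • y) u)) x z =
      dirDeriv x (dirDeriv x (leviForm u y)) z +
        dirDeriv (Complex.I • x) (dirDeriv (Complex.I • x) (leviForm u y)) z := by
  have hy := (hu.dirDeriv y).dirDeriv y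
  have hy' := (hu.dirDeriv (Complex.I • y)).dirDeriv (Complex.I • y)
  have hD : ∀ d, dirDeriv d (dirDeriv d (leviForm u y)) z =
      1 / 4 * (dirDeriv d (dirDeriv d (dirDeriv y (dirDeriv y u))) z +
      dirDeriv d (dirDeriv d (dirDeriv (Complex.I • y) (dirDeriv (Complex.I • y) u))) z) :=
    fun d => by
      have e : leviForm u y = fun z => 1 / 4 * (dirDeriv y (dirDeriv y u) z +
        dirDeriv (Complex.I • y) (dirDeriv (Complex.I • y) u) z) := rfl
      rw [e, dirDeriv_const_mul (hy.add hy'), dirDeriv_add hy hy',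
        dirDeriv_const_mul ((hy.dirDeriv d).add (hy'.dirDeriv d)),
        dirDeriv_add (hy.dirDeriv d) (hy'.dirDeriv d)]
  rw [hD, hD]
  unfold leviForm
  ring

/-- The linearized operator applied to a second derivative of a solution. -/
theorem linearized_leviForm_ge {u f : Cn n → ℝ} (hu : ContDiff ℝ ∞ u) (hf : ContDiff ℝ ∞ f)
    {z : Cn n} {m : ℕ} (hm : m + 1 ≤ n) (heq : ∀ᶠ w in 𝓝 z, hessOp (m + 1) u w = f w)
    (hpos : 0 < f z) {e : OrthonormalBasis (Fin n) ℂ (Cn n)} {x : Fin n → ℝ}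
    (hdiag : hessMat e u z = Matrix.diagonal fun i => (x i : ℂ))
    (hcone : ClosedCone Finset.univ (m + 1) x) (o : Fin n) :
    (dirDeriv (e o) (dirDeriv (e o) f) z - dirDeriv (e o) f z ^ 2 / f z) +
      (dirDeriv (Complex.I • e o) (dirDeriv (Complex.I • e o) f) z -
        dirDeriv (Complex.I • e o) f z ^ 2 / f z) +
      ∑ i ∈ Finset.univ.erase o, esymPred ((Finset.univ.erase o).erase i) m x *
        (dirDeriv (e i) (leviForm u (e o)) z ^ 2 +
          dirDeriv (Complex.I • e i) (leviForm u (e o)) z ^ 2) ≤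
      ∑ i, esym (Finset.univ.erase i) m x *
        (dirDeriv (e i) (dirDeriv (e i) (leviForm u (e o))) z +
          dirDeriv (Complex.I • e i) (dirDeriv (Complex.I • e i) (leviForm u (e o))) z) := by
  have h1 := (differentiated_equation hu hf hm heq hpos hdiag hcone o (e o)).2
  have h2 := (differentiated_equation hu hf hm heq hpos hdiag hcone o (Complex.I • e o)).2
  have h3 : ∑ i ∈ Finset.univ.erase o, esymPred ((Finset.univ.erase o).erase i) m x *
        (dirDeriv (e i) (leviForm u (e o)) z ^ 2 +
          dirDeriv (Complex.I • e i) (leviForm u (e o)) z ^ 2) ≤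
      2 * ∑ i ∈ Finset.univ.erase o, esymPred ((Finset.univ.erase o).erase i) m x *
        ‖hessForm (dirDeriv (e o) u) z (e i) (e o)‖ ^ 2 +
      2 * ∑ i ∈ Finset.univ.erase o, esymPred ((Finset.univ.erase o).erase i) m x *
        ‖hessForm (dirDeriv (Complex.I • e o) u) z (e i) (e o)‖ ^ 2 := by
    rw [Finset.mul_sum, Finset.mul_sum, ← Finset.sum_add_distrib]
    refine Finset.sum_le_sum fun i hi => ?_
    have := mul_le_mul_of_nonneg_left (sq_add_sq_le_hessForm hu z (e i) (e o))
      (hcone.esymPred_erase_nonneg (by simpa using hm) (Finset.ne_of_mem_erase hi))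
    linarith
  have h4 : ∑ i, esym (Finset.univ.erase i) m x *
        (dirDeriv (e i) (dirDeriv (e i) (leviForm u (e o))) z +
          dirDeriv (Complex.I • e i) (dirDeriv (Complex.I • e i) (leviForm u (e o))) z) =
      ∑ i, leviForm (dirDeriv (e o) (dirDeriv (e o) u)) (e i) z *
        esym (Finset.univ.erase i) m x +
      ∑ i, leviForm (dirDeriv (Complex.I • e o) (dirDeriv (Complex.I • e o) u)) (e i) z *
        esym (Finset.univ.erase i) m x := by
    rw [← Finset.sum_add_distrib]
    refine Finset.sum_congr rfl fun i _ => ?_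
    rw [← leviForm_leviForm_comm hu]
    ring
  rw [h4]
  linarith

end ExteriorHessian

/-! ### The test function along a line -/

section Line

theorem hasDerivAt_mul_neg_rpow {G u : ℝ → ℝ} {G' u' a t : ℝ} (hG : HasDerivAt G G' t)
    (hu : HasDerivAt u u' t) (h : u t < 0) :
    HasDerivAt (fun t => G t * (-u t) ^ (-a))
      (G' * (-u t) ^ (-a) + a * (G t * (-u t) ^ (-a)) * u' / (-u t)) t := by
  have hv : 0 < -u t := by linarith
  have h1 := hG.mul (hu.neg.rpow_const (p := -a) (Or.inl hv.ne'))
  convert! h1 using 1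
  simp only [Pi.neg_apply]
  rw [Real.rpow_sub_one hv.ne']
  field_simp

/-- These are the first and second derivative tests for the logarithm of the test function. With `v
= -u` and `U = u'/v` one has `U' = u''/v + U^2`, and `p` is the derivative of `P = G v^(-a)`. Hence
`P'' = v^(-a) G'' + 2 a U p - a (a - 1) P U^2 + a P u''/v`. -/
theorem test_function_conditions {L L₁ u u₁ G G₁ : ℝ → ℝ} {L₂ u₂ G₂ a b σ M : ℝ}
    (hL : ∀ t, HasDerivAt L (L₁ t) t) (hu : ∀ t, HasDerivAt u (u₁ t) t)
    (hG : ∀ t, HasDerivAt G (G₁ t) t) (hL₁ : HasDerivAt L₁ L₂ 0) (hu₁ : HasDerivAt u₁ u₂ 0)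
    (hG₁ : HasDerivAt G₁ G₂ 0) (hL0 : 0 < L 0) (hu0 : u 0 < 0)
    (hN : 0 < M - G 0 * (-u 0) ^ (-a))
    (hmax : IsLocalMax (fun t => L t * (-u t) ^ (-b) * (M - G t * (-u t) ^ (-a)) ^ (-σ)) 0)
    {P N U p : ℝ} (hP : P = G 0 * (-u 0) ^ (-a)) (hNe : N = M - P) (hU : U = u₁ 0 / (-u 0))
    (hp : p = (-u 0) ^ (-a) * G₁ 0 + a * P * U) :
    L₁ 0 / L 0 + b * U + σ * (p / N) = 0 ∧
    L₂ / L 0 - (L₁ 0 / L 0) ^ 2 + b * (u₂ / (-u 0) + U ^ 2) +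
      σ * (((-u 0) ^ (-a) * G₂ + 2 * a * U * p - a * (a - 1) * P * U ^ 2 +
        a * P * (u₂ / (-u 0))) / N + (p / N) ^ 2) ≤ 0 := by
  have cL : ContinuousAt L 0 := (hL 0).continuousAt
  have cu : ContinuousAt u 0 := (hu 0).continuousAt
  have hev_u : ∀ᶠ t in 𝓝 (0 : ℝ), u t < 0 := cu.eventually_lt_const hu0
  have hev_L : ∀ᶠ t in 𝓝 (0 : ℝ), 0 < L t := cL.eventually_const_lt hL0
  have hQ : ∀ t, u t < 0 → HasDerivAt (fun t => G t * (-u t) ^ (-a))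
      (G₁ t * (-u t) ^ (-a) + a * (G t * (-u t) ^ (-a)) * u₁ t / (-u t)) t :=
    fun t ht => hasDerivAt_mul_neg_rpow (hG t) (hu t) ht
  have hev_N : ∀ᶠ t in 𝓝 (0 : ℝ), 0 < M - G t * (-u t) ^ (-a) :=
    ((hQ 0 hu0).const_sub M).continuousAt.eventually_const_lt hN
  have hv : 0 < -u 0 := by linarith
  have hmax' : IsLocalMax (fun t => Real.log (L t) - b * Real.log (-u t) -
      σ * Real.log (M - G t * (-u t) ^ (-a))) 0 := by
    have hlog : ∀ t, u t < 0 → 0 < L t → 0 < M - G t * (-u t) ^ (-a) →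
        Real.log (L t * (-u t) ^ (-b) * (M - G t * (-u t) ^ (-a)) ^ (-σ)) =
        Real.log (L t) - b * Real.log (-u t) - σ * Real.log (M - G t * (-u t) ^ (-a)) := by
      intro t h1 h2 h3
      have h4 : 0 < -u t := by linarith
      rw [Real.log_mul (by positivity) (by positivity), Real.log_mul (by positivity)
        (by positivity), Real.log_rpow h4, Real.log_rpow h3]
      ring
    filter_upwards [hmax, hev_u, hev_L, hev_N] with t h0 h1 h2 h3
    rw [← hlog t h1 h2 h3, ← hlog 0 hu0 hL0 hN]
    have h4 : 0 < -u t := by linarith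
    exact Real.log_le_log (by positivity) h0
  have hφ : ∀ᶠ t in 𝓝 (0 : ℝ), HasDerivAt (fun t => Real.log (L t) - b * Real.log (-u t) -
      σ * Real.log (M - G t * (-u t) ^ (-a)))
      (L₁ t / L t + b * (u₁ t / (-u t)) + σ * ((G₁ t * (-u t) ^ (-a) +
        a * (G t * (-u t) ^ (-a)) * u₁ t / (-u t)) / (M - G t * (-u t) ^ (-a)))) t := by
    filter_upwards [hev_u, hev_L, hev_N] with t h1 h2 h3
    have h4 : -u t ≠ 0 := by linarith
    convert! (((hL t).log h2.ne').sub (((hu t).fun_neg.log h4).const_mul b)).sub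
      ((((hQ t h1).const_sub M).log h3.ne').const_mul σ) using 1
    ring
  have d1 := hL₁.fun_div (hL 0) hL0.ne'
  have d2 := hu₁.fun_div (hu 0).fun_neg hv.ne'
  have d3 := (hasDerivAt_mul_neg_rpow (a := a) hG₁ (hu 0) hu0)
  have d4 := ((((hQ 0 hu0).const_mul a).fun_mul hu₁).fun_div (hu 0).fun_neg hv.ne')
  have d5 := (d3.fun_add d4).fun_div ((hQ 0 hu0).const_sub M) hN.ne'
  obtain ⟨r1, r2⟩ := hmax'.second_derivative_nonpos hφ
    ((d1.fun_add (d2.const_mul b)).fun_add (d5.const_mul σ))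
  rw [← hP, ← hNe] at r1 r2 hN
  subst hU
  have hp' : G₁ 0 * (-u 0) ^ (-a) + a * P * u₁ 0 / (-u 0) = p := by rw [hp]; ring
  rw [hp'] at r1 r2
  refine ⟨r1, ?_⟩
  refine le_trans (le_of_eq ?_) r2
  have hG1 : G₁ 0 * (-u 0) ^ (-a) = p - a * P * (u₁ 0 / (-u 0)) := by rw [hp]; ring
  rw [hG1]
  have hu0' : u 0 ≠ 0 := hu0.ne
  field_simp
  ring

end Line

/-! ### The algebraic form of the estimate -/

section Algebra

/-- Put `δ = 5/(16 b)`. If `li ≥ -δ lo`, then `-li * S ≤ δ lo S`, and `lo * S ≤ wi` whenever the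
coefficient is positive. If `li < -δ lo`, then `wi` itself is at most `wi * li ^ 2 / (δ lo) ^ 2`. -/
theorem bad_coefficient_le {wo wi lo li S b : ℝ} (hlo : 0 < lo) (hb : 0 < b) (hwo : 0 ≤ wo)
    (hwi : 0 ≤ wi) (hS : 0 ≤ S) (h : wi - lo * S = wo - li * S) :
    wi - lo * S ≤ wo + wi * li ^ 2 / lo ^ 2 * (16 * b / 5) ^ 2 + 5 / (16 * b) * wi := by
  have h1 : 0 ≤ wi * li ^ 2 / lo ^ 2 * (16 * b / 5) ^ 2 := by positivity
  have h2 : 0 ≤ 5 / (16 * b) * wi := by positivity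
  rcases le_or_gt (wi - lo * S) 0 with hr | hr
  · linarith
  rcases le_or_gt (-(5 / (16 * b) * lo)) li with hl | hl
  · have : -li * S ≤ 5 / (16 * b) * lo * S := mul_le_mul_of_nonneg_right (by linarith) hS
    have h3 : 5 / (16 * b) * (lo * S) ≤ 5 / (16 * b) * wi :=
      mul_le_mul_of_nonneg_left (by linarith) (by positivity)
    linarith
  · have h3 : lo ^ 2 ≤ li ^ 2 * (16 * b / 5) ^ 2 := by
      rw [← mul_pow]
      have : lo ≤ -li * (16 * b / 5) := by
        have h4 : 5 / (16 * b) * lo * (16 * b / 5) = lo := by field_simp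
        have h5 : 5 / (16 * b) * lo * (16 * b / 5) ≤ -li * (16 * b / 5) :=
          mul_le_mul_of_nonneg_right (by linarith) (by positivity)
        linarith
      nlinarith
    have h4 : wi ≤ wi * li ^ 2 / lo ^ 2 * (16 * b / 5) ^ 2 := by
      rw [div_mul_eq_mul_div, le_div_iff₀ (by positivity), mul_assoc]
      exact mul_le_mul_of_nonneg_left h3 hwi
    have : 0 ≤ lo * S := by positivity
    linarith

/-- By the first order condition `q ^ 2 ≤ 2 b² U² + 2 σ² Z²`. Of the available `b U²`, the share
`5/8` absorbs the `w` part of `r`, `1/8` the term with `a (a - 1)`, and `1/4` the cross term, after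
completing the square with half of `σ Z²`. The other half of `σ Z²` absorbs `2 σ² Z²`. -/
theorem direction_bound {a b σ r w ρ R U Z q : ℝ} (hb : 0 < b)
    (hσ : 0 < σ) (hσa : 8 * a ^ 2 * σ ≤ b) (hab : a * (a - 1) ≤ a ^ 2) (hσ4 : 4 * σ ≤ 1)
    (hw : 0 ≤ w) (hρ : 0 ≤ ρ) (hrw : r ≤ w) (hrρ : r ≤ ρ + 5 / (16 * b) * w) (hR0 : 0 ≤ R)
    (hR1 : R ≤ 1) (hq : q + b * U + σ * Z = 0) :
    -(2 * b ^ 2 * U ^ 2 * ρ) ≤ -(r * q ^ 2) +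
      w * (b * U ^ 2 + 2 * a * σ * U * Z - σ * (a * (a - 1)) * R * U ^ 2 + σ * Z ^ 2) := by
  have hq2 : q ^ 2 ≤ 2 * b ^ 2 * U ^ 2 + 2 * σ ^ 2 * Z ^ 2 := by
    have : q = -(b * U + σ * Z) := by linarith
    rw [this]
    nlinarith [sq_nonneg (b * U - σ * Z)]
  have hr1 : r * q ^ 2 ≤ 2 * b ^ 2 * U ^ 2 * (ρ + 5 / (16 * b) * w) + 2 * σ ^ 2 * Z ^ 2 * w := by
    rcases le_or_gt r 0 with h | h
    · have h1 : r * q ^ 2 ≤ 0 := mul_nonpos_of_nonpos_of_nonneg h (sq_nonneg _)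
      have h2 : 0 ≤ 2 * b ^ 2 * U ^ 2 * (ρ + 5 / (16 * b) * w) + 2 * σ ^ 2 * Z ^ 2 * w := by
        positivity
      linarith
    · calc r * q ^ 2 ≤ r * (2 * b ^ 2 * U ^ 2 + 2 * σ ^ 2 * Z ^ 2) :=
            mul_le_mul_of_nonneg_left hq2 h.le
        _ = 2 * b ^ 2 * U ^ 2 * r + 2 * σ ^ 2 * Z ^ 2 * r := by ring
        _ ≤ _ := add_le_add (mul_le_mul_of_nonneg_left hrρ (by positivity))
            (mul_le_mul_of_nonneg_left hrw (by positivity))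
  have e : 2 * b ^ 2 * U ^ 2 * (ρ + 5 / (16 * b) * w) =
      2 * b ^ 2 * U ^ 2 * ρ + w * (5 / 8 * b * U ^ 2) := by field_simp; ring
  have h3 : σ * (a * (a - 1)) * R * U ^ 2 ≤ b / 8 * U ^ 2 := by
    refine mul_le_mul_of_nonneg_right ?_ (sq_nonneg _)
    have h5 : a * (a - 1) * R ≤ a ^ 2 := by
      rcases le_or_gt (a * (a - 1)) 0 with h | h
      · have := mul_nonpos_of_nonpos_of_nonneg h hR0
        linarith [sq_nonneg a]
      · have := mul_le_mul_of_nonneg_left hR1 h.le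
        linarith
    have := mul_le_mul_of_nonneg_left h5 hσ.le
    nlinarith
  have h4 : 0 ≤ b * U ^ 2 + 2 * a * σ * U * Z - σ * (a * (a - 1)) * R * U ^ 2 + σ * Z ^ 2 -
      5 / 8 * b * U ^ 2 - 2 * σ ^ 2 * Z ^ 2 := by
    have i1 : 2 * σ ^ 2 * Z ^ 2 ≤ σ / 2 * Z ^ 2 :=
      mul_le_mul_of_nonneg_right (by nlinarith) (sq_nonneg _)
    have i2 : 0 ≤ σ / 2 * (Z + 2 * a * U) ^ 2 := by positivity
    have i3 : 2 * a ^ 2 * σ * U ^ 2 ≤ b / 4 * U ^ 2 :=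
      mul_le_mul_of_nonneg_right (by linarith) (sq_nonneg _)
    nlinarith
  have := mul_nonneg hw h4
  nlinarith

end Algebra

/-! ### From the summed test conditions to a bound for the largest eigenvalue -/

section Core

/-- The bound for the scaled largest eigenvalue at an interior maximum. -/
noncomputable def eigenvalueBound (b σ κ K₀ K₁ K₂ N₁ : ℝ) : ℝ :=
  1 + 4 * b ^ 2 * K₀ * (1 + (16 * b / 5) ^ 2) * N₁ / σ + (N₁ * K₂ / σ + 2 * (K₀ + K₁)) / κ

/-- In terms of `μ = l / y` all powers of `v` cancel. If `μ` exceeds the bound, its second summand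
makes the term with `1 / l ^ 2` at most half of the good term in `W`. The remaining half, with `W ≥
κ f l`, bounds `μ` by the third summand. -/
theorem scaled_le_of_quadratic {b σ κ K₀ K₁ K₂ N N₁ y v l f W : ℝ} (hσ : 0 < σ)
    (hκ : 0 < κ) (hK₀ : 0 ≤ K₀) (hK₁ : 0 ≤ K₁) (hK₂ : 0 ≤ K₂) (hN : 1 ≤ N) (hN₁ : N ≤ N₁)
    (hy : 0 < y) (hv : 0 < v) (hl : 0 < l) (hf : 0 < f) (hW : κ * f * l ≤ W)
    (h : -(2 * f * K₂ * (y / v)) / l + σ / N * (y * v)⁻¹ * (4 * W - 4 * f * (K₀ + K₁) * y) -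
      2 * b ^ 2 * ((1 + (16 * b / 5) ^ 2) * W / l ^ 2) * (4 * K₀ * (y / v)) ≤ 0) :
    l ≤ eigenvalueBound b σ κ K₀ K₁ K₂ N₁ * y := by
  have hN0 : 0 < N := by linarith
  have hN10 : 0 < N₁ := by linarith
  obtain ⟨μ, rfl⟩ : ∃ μ, l = μ * y := ⟨l / y, by field_simp⟩
  have hμ : 0 < μ := pos_of_mul_pos_left hl hy.le
  have hW0 : 0 < W := lt_of_lt_of_le (by positivity) hW
  refine mul_le_mul_of_nonneg_right ?_ hy.le
  by_contra! hcon
  unfold eigenvalueBound at hcon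
  set c := 1 + (16 * b / 5) ^ 2 with hc
  have hc0 : 0 < c := by positivity
  have t1 : 0 ≤ 4 * b ^ 2 * K₀ * c * N₁ / σ := by positivity
  have t2 : 0 ≤ (N₁ * K₂ / σ + 2 * (K₀ + K₁)) / κ := by positivity
  have hμ1 : 1 < μ := by linarith
  have h1 : (2 * σ / N) * (W / y) ≤ 2 * f * K₂ / μ + 4 * σ / N * f * (K₀ + K₁) := by
    have e : -(2 * f * K₂ * (y / v)) / (μ * y) +
        σ / N * (y * v)⁻¹ * (4 * W - 4 * f * (K₀ + K₁) * y) -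
        2 * b ^ 2 * (c * W / (μ * y) ^ 2) * (4 * K₀ * (y / v)) =
        (-(2 * f * K₂ / μ) + 4 * σ / N * (W / y) - 4 * σ / N * f * (K₀ + K₁) -
          8 * b ^ 2 * c * K₀ / μ ^ 2 * (W / y)) / v := by
      field_simp
      ring
    rw [e, div_le_iff₀ hv, zero_mul] at h
    have h2 : 8 * b ^ 2 * c * K₀ / μ ^ 2 ≤ 2 * σ / N := by
      rw [div_le_div_iff₀ (by positivity) hN0]
      have h3 : 4 * b ^ 2 * K₀ * c * N₁ / σ ≤ μ ^ 2 := by nlinarith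
      rw [div_le_iff₀ hσ] at h3
      have h4 : 8 * b ^ 2 * c * K₀ * N ≤ 8 * b ^ 2 * c * K₀ * N₁ :=
        mul_le_mul_of_nonneg_left hN₁ (by positivity)
      linarith
    have h3 := mul_le_mul_of_nonneg_right h2 (show 0 ≤ W / y by positivity)
    have h4 : 2 * (2 * σ / N * (W / y)) = 4 * σ / N * (W / y) := by ring
    linarith
  have h2 : κ * f * μ ≤ W / y := by
    rw [le_div_iff₀ hy]
    linarith
  have h3 : 2 * f * K₂ / μ ≤ 2 * f * K₂ := div_le_self (by positivity) hμ1.le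
  have h4 : (2 * σ / N) * (κ * f * μ) ≤ 2 * f * K₂ + 4 * σ / N * f * (K₀ + K₁) :=
    (mul_le_mul_of_nonneg_left h2 (by positivity)).trans (h1.trans (by linarith))
  have h5 : μ ≤ (N * K₂ / σ + 2 * (K₀ + K₁)) / κ := by
    rw [le_div_iff₀ hκ]
    have e1 : (2 * σ / N) * (κ * f * μ) = (2 * σ * f / N) * (μ * κ) := by ring
    have e2 : 2 * f * K₂ + 4 * σ / N * f * (K₀ + K₁) =
        (2 * σ * f / N) * (N * K₂ / σ + 2 * (K₀ + K₁)) := by field_simp; ring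
    rw [e1, e2] at h4
    exact le_of_mul_le_mul_left h4 (by positivity)
  have h6 : (N * K₂ / σ + 2 * (K₀ + K₁)) / κ ≤ (N₁ * K₂ / σ + 2 * (K₀ + K₁)) / κ := by
    gcongr
  linarith

/-- Here `D` stands for the real directions and `π` for the complex index of a direction. `S`
collects the third order coefficients `S_{k-2}` without `x o` and `x i`. Multiplying the second
order conditions by `w (π d)` and adding leaves `w - l o * S` in front of the squared first
derivatives, and this is what `bad_coefficient_le` and `direction_bound` handle. -/
theorem eigenvalue_le_of_test_conditions {ι D : Type*} [Fintype ι] [Fintype D] (o : ι) (π : D → ι)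
    {w l S : ι → ℝ} {L₁ L₂ U u₂ p G₂ : D → ℝ} {a b σ κ v y N N₁ P K₀ K₁ K₂ f : ℝ}
    (hb : 0 < b) (hσ : 0 < σ) (hσa : 8 * a ^ 2 * σ ≤ b) (ha : 0 ≤ a)
    (hσ4 : 4 * σ ≤ 1) (hκ : 0 < κ) (hK₀ : 0 ≤ K₀) (hK₁ : 0 ≤ K₁) (hK₂ : 0 ≤ K₂)
    (hN : 1 ≤ N) (hN₁ : N ≤ N₁) (hP : 0 ≤ P) (hPN : P ≤ N) (hy : 0 < y) (hv : 0 < v)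
    (hf : 0 < f) (hlo : 0 < l o) (hw : ∀ i, 0 ≤ w i) (hS : ∀ i, 0 ≤ S i)
    (hwS : ∀ i, w i - l o * S i = w o - l i * S i) (hW : κ * f * l o ≤ ∑ i, w i * l i ^ 2)
    (hfirst : ∀ d, L₁ d / l o + b * U d + σ * (p d / N) = 0)
    (hsecond : ∀ d, L₂ d / l o - (L₁ d / l o) ^ 2 + b * (u₂ d / v + U d ^ 2) +
      σ * (((y * v)⁻¹ * G₂ d + 2 * a * U d * p d - a * (a - 1) * P * U d ^ 2 +
        a * P * (u₂ d / v)) / N + (p d / N) ^ 2) ≤ 0)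
    (hU : ∑ d, U d ^ 2 ≤ 4 * K₀ * (y / v)) (hu₂ : 0 ≤ ∑ d, w (π d) * u₂ d)
    (hL₂ : -(2 * f * K₂ * (y / v)) + ∑ d, S (π d) * L₁ d ^ 2 ≤ ∑ d, w (π d) * L₂ d)
    (hG₂ : 4 * ∑ i, w i * l i ^ 2 - 4 * f * (K₀ + K₁) * y ≤ ∑ d, w (π d) * G₂ d) :
    l o ≤ eigenvalueBound b σ κ K₀ K₁ K₂ N₁ * y := by
  have hN0 : 0 < N := by linarith
  set W := ∑ i, w i * l i ^ 2 with hWdef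
  refine scaled_le_of_quadratic hσ hκ hK₀ hK₁ hK₂ hN hN₁ hy hv hlo hf hW ?_
  set ρ := (1 + (16 * b / 5) ^ 2) * W / l o ^ 2 with hρ
  have hWi : ∀ i, w i * l i ^ 2 ≤ W := fun i =>
    Finset.single_le_sum (f := fun i => w i * l i ^ 2)
      (fun j _ => mul_nonneg (hw j) (sq_nonneg _)) (Finset.mem_univ i)
  have hW0 : 0 ≤ W := Finset.sum_nonneg fun i _ => mul_nonneg (hw i) (sq_nonneg _)
  have hρ0 : 0 ≤ ρ := by positivity
  have hr : ∀ i, w i - l o * S i ≤ ρ + 5 / (16 * b) * w i := by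
    intro i
    have h1 := bad_coefficient_le hlo hb (hw o) (hw i) (hS i) (hwS i)
    have h2 : w o ≤ W / l o ^ 2 := by
      rw [le_div_iff₀ (by positivity)]
      exact hWi o
    have h3 : w i * l i ^ 2 / l o ^ 2 * (16 * b / 5) ^ 2 ≤ W / l o ^ 2 * (16 * b / 5) ^ 2 := by
      have := hWi i
      gcongr
    have h4 : ρ = W / l o ^ 2 + W / l o ^ 2 * (16 * b / 5) ^ 2 := by rw [hρ]; ring
    linarith
  have hdir : ∀ d, -(2 * b ^ 2 * ρ * U d ^ 2) ≤ -((w (π d) - l o * S (π d)) * (L₁ d / l o) ^ 2) +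
      w (π d) * (b * U d ^ 2 + 2 * a * σ * U d * (p d / N) -
        σ * (a * (a - 1)) * (P / N) * U d ^ 2 + σ * (p d / N) ^ 2) := by
    intro d
    have := direction_bound hb hσ hσa (by nlinarith) hσ4 (hw (π d)) hρ0
      (sub_le_self _ (mul_nonneg hlo.le (hS (π d)))) (hr (π d)) (div_nonneg hP hN0.le)
      (div_le_one_of_le₀ hPN hN0.le) (hfirst d)
    linarith
  have hsum := Finset.sum_le_sum fun d (_ : d ∈ Finset.univ) => hdir d
  have hsec : ∑ d, w (π d) * (L₂ d / l o - (L₁ d / l o) ^ 2 + b * (u₂ d / v + U d ^ 2) +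
      σ * (((y * v)⁻¹ * G₂ d + 2 * a * U d * p d - a * (a - 1) * P * U d ^ 2 +
        a * P * (u₂ d / v)) / N + (p d / N) ^ 2)) ≤ 0 :=
    Finset.sum_nonpos fun d _ => mul_nonpos_of_nonneg_of_nonpos (hw _) (hsecond d)
  have hexp : ∑ d, w (π d) * (L₂ d / l o - (L₁ d / l o) ^ 2 + b * (u₂ d / v + U d ^ 2) +
      σ * (((y * v)⁻¹ * G₂ d + 2 * a * U d * p d - a * (a - 1) * P * U d ^ 2 +
        a * P * (u₂ d / v)) / N + (p d / N) ^ 2)) =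
      (∑ d, w (π d) * L₂ d - ∑ d, S (π d) * L₁ d ^ 2) / l o +
      (b / v + σ * a * P / (N * v)) * ∑ d, w (π d) * u₂ d +
      σ / N * (y * v)⁻¹ * ∑ d, w (π d) * G₂ d +
      ∑ d, (-((w (π d) - l o * S (π d)) * (L₁ d / l o) ^ 2) +
      w (π d) * (b * U d ^ 2 + 2 * a * σ * U d * (p d / N) -
        σ * (a * (a - 1)) * (P / N) * U d ^ 2 + σ * (p d / N) ^ 2)) := by
    rw [← Finset.sum_sub_distrib, Finset.sum_div, Finset.mul_sum, Finset.mul_sum,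
      ← Finset.sum_add_distrib, ← Finset.sum_add_distrib, ← Finset.sum_add_distrib]
    refine Finset.sum_congr rfl fun d _ => ?_
    field_simp
    ring
  rw [hexp] at hsec
  have g1 : -(2 * f * K₂ * (y / v)) / l o ≤
      (∑ d, w (π d) * L₂ d - ∑ d, S (π d) * L₁ d ^ 2) / l o := by
    refine div_le_div_of_nonneg_right ?_ hlo.le
    linarith
  have g2 : 0 ≤ (b / v + σ * a * P / (N * v)) * ∑ d, w (π d) * u₂ d :=
    mul_nonneg (by positivity) hu₂
  have g3 : σ / N * (y * v)⁻¹ * (4 * W - 4 * f * (K₀ + K₁) * y) ≤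
      σ / N * (y * v)⁻¹ * ∑ d, w (π d) * G₂ d :=
    mul_le_mul_of_nonneg_left hG₂ (by positivity)
  have g4 : 2 * b ^ 2 * ρ * ∑ d, U d ^ 2 ≤ 2 * b ^ 2 * ρ * (4 * K₀ * (y / v)) :=
    mul_le_mul_of_nonneg_left hU (by positivity)
  have g5 : ∑ d, -(2 * b ^ 2 * ρ * U d ^ 2) = -(2 * b ^ 2 * ρ * ∑ d, U d ^ 2) := by
    rw [Finset.mul_sum, Finset.sum_neg_distrib]
  linarith

end Core

/-! ### Calculus rules for directional derivatives -/

section DirectionalRules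
variable {E : Type*} [NormedAddCommGroup E] [NormedSpace ℝ E]

theorem dirDeriv_mul {g h : E → ℝ} (hg : ContDiff ℝ ∞ g) (hh : ContDiff ℝ ∞ h) (d : E) :
    dirDeriv d (fun z => g z * h z) = fun z => g z * dirDeriv d h z + dirDeriv d g z * h z := by
  ext z
  unfold dirDeriv
  rw [fderiv_fun_mul (hg.differentiable (by simp) z) (hh.differentiable (by simp) z)]
  simp [mul_comm]

theorem dirDeriv_sum {ι : Type*} (s : Finset ι) {g : ι → E → ℝ} (hg : ∀ i, ContDiff ℝ ∞ (g i))
    (d : E) : dirDeriv d (fun z => ∑ i ∈ s, g i z) = fun z => ∑ i ∈ s, dirDeriv d (g i) z := by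
  ext z
  unfold dirDeriv
  rw [fderiv_fun_sum fun i _ => (hg i).differentiable (by simp) z]
  simp

theorem dirDeriv_exp {g : E → ℝ} (hg : ContDiff ℝ ∞ g) (d : E) :
    dirDeriv d (fun z => Real.exp (g z)) = fun z => Real.exp (g z) * dirDeriv d g z := by
  ext z
  unfold dirDeriv
  rw [fderiv_exp (hg.differentiable (by simp) z)]
  simp

/-- The combination left by log-concavity of `S_k` is exactly `f (log f)''`, so only second
derivatives of `log f` enter. -/
theorem dirDeriv_dirDeriv_exp {g : E → ℝ} (hg : ContDiff ℝ ∞ g) (d z : E) :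
    dirDeriv d (dirDeriv d fun z => Real.exp (g z)) z -
      dirDeriv d (fun z => Real.exp (g z)) z ^ 2 / Real.exp (g z) =
      Real.exp (g z) * dirDeriv d (dirDeriv d g) z := by
  rw [dirDeriv_exp hg, dirDeriv_mul hg.exp (hg.dirDeriv d), dirDeriv_exp hg]
  field_simp
  ring

theorem abs_dirDeriv_dirDeriv_le {g : E → ℝ} (hg : ContDiff ℝ ∞ g) {d : E} (hd : ‖d‖ = 1)
    (z : E) : |dirDeriv d (dirDeriv d g) z| ≤ ‖iteratedFDeriv ℝ 2 g z‖ := by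
  rw [dirDeriv_dirDeriv hg]
  have h := (iteratedFDeriv ℝ 2 g z).le_opNorm ![d, d]
  rw [iteratedFDeriv_two_apply] at h
  simpa [Fin.prod_univ_two, hd] using h

theorem dirDeriv_dirDeriv_sum_sq {ι : Type*} [Fintype ι] {g : ι → E → ℝ}
    (hg : ∀ i, ContDiff ℝ ∞ (g i)) (d z : E) :
    dirDeriv d (dirDeriv d fun z => 1 / 4 * ∑ i, g i z ^ 2) z =
      1 / 2 * ∑ i, (dirDeriv d (g i) z ^ 2 + g i z * dirDeriv d (dirDeriv d (g i)) z) := by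
  have h1 : ∀ i, (fun z => g i z ^ 2) = fun z => g i z * g i z := fun i => by ext z; ring
  have hs : ∀ i, ContDiff ℝ ∞ (fun z => g i z ^ 2) := fun i => (hg i).pow 2
  have h2 : ∀ i, dirDeriv d (fun z => g i z ^ 2) = fun z => 2 * (g i z * dirDeriv d (g i) z) :=
    fun i => by
      rw [h1, dirDeriv_mul (hg i) (hg i)]
      ext z; ring
  have hm : ∀ i, ContDiff ℝ ∞ (fun z => g i z * dirDeriv d (g i) z) := fun i =>
    (hg i).mul ((hg i).dirDeriv d)
  rw [dirDeriv_const_mul (ContDiff.sum fun i _ => hs i), dirDeriv_sum _ hs]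
  simp only [h2]
  rw [dirDeriv_const_mul (ContDiff.sum fun i _ => contDiff_const.mul (hm i)),
    dirDeriv_sum _ fun i => contDiff_const.mul (hm i)]
  simp only [dirDeriv_const_mul (hm _), dirDeriv_mul (hg _) ((hg _).dirDeriv d)]
  rw [Finset.mul_sum, Finset.mul_sum]
  refine Finset.sum_congr rfl fun i _ => ?_
  ring

end DirectionalRules

/-! ### The linearized operator on `|Du|²` and the interior estimate -/

namespace ExteriorHessian
variable {n : ℕ}

/-- The real orthonormal frame `e_i, √-1 e_i` of a unitary frame `e_i`. -/
noncomputable def realFrame (e : OrthonormalBasis (Fin n) ℂ (Cn n)) (d : Fin n × Bool) : Cn n :=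
  if d.2 then e d.1 else Complex.I • e d.1

theorem sum_realFrame (e : OrthonormalBasis (Fin n) ℂ (Cn n)) (F : Fin n → Cn n → ℝ) :
    ∑ d : Fin n × Bool, F d.1 (realFrame e d) = ∑ i, (F i (e i) + F i (Complex.I • e i)) := by
  rw [Fintype.sum_prod_type]
  simp [realFrame]

theorem gradSq_eq_sum_realFrame {g : Cn n → ℝ} (hg : ContDiff ℝ ∞ g)
    (e : OrthonormalBasis (Fin n) ℂ (Cn n)) :
    gradSq g = fun z => 1 / 4 * ∑ d, dirDeriv (realFrame e d) g z ^ 2 := by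
  ext z
  rw [gradSq_eq_sum hg e z, sum_realFrame e fun _ v => dirDeriv v g z ^ 2]

theorem sum_mul_dirDeriv_dirDeriv {g : Cn n → ℝ} (e : OrthonormalBasis (Fin n) ℂ (Cn n))
    (w : Fin n → ℝ) (z : Cn n) :
    ∑ d : Fin n × Bool, w d.1 * dirDeriv (realFrame e d) (dirDeriv (realFrame e d) g) z =
      4 * ∑ i, leviForm g (e i) z * w i := by
  rw [sum_realFrame e fun i v => w i * dirDeriv v (dirDeriv v g) z, Finset.mul_sum]
  refine Finset.sum_congr rfl fun i _ => ?_
  unfold leviForm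
  ring

theorem levi_le_of_hessMat_eq_diagonal {u : Cn n → ℝ} (hu : ContDiff ℝ ∞ u) {z : Cn n}
    {e : OrthonormalBasis (Fin n) ℂ (Cn n)} {x : Fin n → ℝ}
    (hdiag : hessMat e u z = Matrix.diagonal fun i => (x i : ℂ)) {o : Fin n}
    (ho : ∀ i, x i ≤ x o) {ξ : Cn n} (hξ : ‖ξ‖ = 1) : levi u z ξ ≤ x o := by
  have hd : ∀ i j, hessForm u z (e i) (e j) = if i = j then (x i : ℂ) else 0 := fun i j => by
    have := congrFun (congrFun hdiag i) j
    rwa [Matrix.diagonal_apply] at this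
  have h1 : hessForm u z ξ ξ = ((∑ i, ‖e.repr ξ i‖ ^ 2 * x i : ℝ) : ℂ) := by
    conv_lhs => rw [← e.sum_repr ξ]
    rw [hessForm_sum_left hu, Complex.ofReal_sum]
    refine Finset.sum_congr rfl fun i _ => ?_
    rw [hessForm_sum_right hu]
    simp only [hd, mul_ite, mul_zero]
    rw [Finset.sum_ite_eq Finset.univ i, if_pos (Finset.mem_univ i), ← mul_assoc,
      Complex.mul_conj']
    push_cast
    rfl
  have h2 : levi u z ξ = ∑ i, ‖e.repr ξ i‖ ^ 2 * x i := by
    rw [levi_eq_leviForm hu]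
    rw [hessForm_self hu] at h1
    exact_mod_cast h1
  have h3 : ∑ i, ‖e.repr ξ i‖ ^ 2 = 1 := by
    rw [← EuclideanSpace.norm_sq_eq, e.repr.norm_map, hξ]
    norm_num
  rw [h2]
  calc ∑ i, ‖e.repr ξ i‖ ^ 2 * x i ≤ ∑ i, ‖e.repr ξ i‖ ^ 2 * x o :=
        Finset.sum_le_sum fun i _ => mul_le_mul_of_nonneg_left (ho i) (sq_nonneg _)
    _ = x o := by rw [← Finset.sum_mul, h3, one_mul]

theorem gradSq_nonneg (g : Cn n → ℝ) (z : Cn n) : 0 ≤ gradSq g z :=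
  Finset.sum_nonneg fun _ _ => sq_nonneg _

/-- The linearized operator applied to `|Du|²`. -/
theorem linearized_gradSq_ge {u g : Cn n → ℝ} (hu : ContDiff ℝ ∞ u) (hg : ContDiff ℝ ∞ g)
    {z : Cn n} {m : ℕ} (hm : m + 1 ≤ n)
    (heq : ∀ᶠ w in 𝓝 z, hessOp (m + 1) u w = Real.exp (g w))
    {e : OrthonormalBasis (Fin n) ℂ (Cn n)} {x : Fin n → ℝ}
    (hdiag : hessMat e u z = Matrix.diagonal fun i => (x i : ℂ))
    (hcone : ClosedCone Finset.univ (m + 1) x) (hw : ∀ i, 0 ≤ esym (Finset.univ.erase i) m x)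
    {v : ℝ} (hv : 0 < v) :
    4 * ∑ i, esym (Finset.univ.erase i) m x * x i ^ 2 -
      4 * Real.exp (g z) * (gradSq u z / v + v * gradSq g z) ≤
      ∑ d : Fin n × Bool, esym (Finset.univ.erase d.1) m x *
        dirDeriv (realFrame e d) (dirDeriv (realFrame e d) (gradSq u)) z := by
  set w : Fin n → ℝ := fun i => esym (Finset.univ.erase i) m x with hwdef
  have hdir : ∀ d', ContDiff ℝ ∞ (dirDeriv (realFrame e d') u) := fun d' => hu.dirDeriv _
  have hG : ∀ d, dirDeriv (realFrame e d) (dirDeriv (realFrame e d) (gradSq u)) z =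
      1 / 2 * ∑ d', (dirDeriv (realFrame e d) (dirDeriv (realFrame e d') u) z ^ 2 +
        dirDeriv (realFrame e d') u z * dirDeriv (realFrame e d) (dirDeriv (realFrame e d)
          (dirDeriv (realFrame e d') u)) z) := fun d => by
    rw [gradSq_eq_sum_realFrame hu e]
    exact dirDeriv_dirDeriv_sum_sq hdir _ z
  have hx : ∀ i, leviForm u (e i) z = x i := fun i => by
    have := congrFun (congrFun hdiag i) i
    rw [hessMat, Matrix.of_apply, hessForm_self hu, Matrix.diagonal_apply_eq] at this
    exact_mod_cast this
  -- Only the pure second derivatives `d' = d` are needed: with `x i = (A + B)/4`, the inequality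
  -- `(A + B)^2 ≤ 2 (A^2 + B^2)` suffices.
  have h1 : 4 * ∑ i, w i * x i ^ 2 ≤ ∑ d : Fin n × Bool, w d.1 *
      (1 / 2 * ∑ d', dirDeriv (realFrame e d) (dirDeriv (realFrame e d') u) z ^ 2) := by
    have h2 : ∀ d : Fin n × Bool, w d.1 * (1 / 2 *
        dirDeriv (realFrame e d) (dirDeriv (realFrame e d) u) z ^ 2) ≤ w d.1 *
        (1 / 2 * ∑ d', dirDeriv (realFrame e d) (dirDeriv (realFrame e d') u) z ^ 2) := by
      intro d
      refine mul_le_mul_of_nonneg_left (mul_le_mul_of_nonneg_left ?_ (by norm_num)) (hw _)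
      exact Finset.single_le_sum
        (f := fun d' => dirDeriv (realFrame e d) (dirDeriv (realFrame e d') u) z ^ 2)
        (fun _ _ => sq_nonneg _) (Finset.mem_univ d)
    refine le_trans ?_ (Finset.sum_le_sum fun d _ => h2 d)
    rw [sum_realFrame e fun i v => w i * (1 / 2 * dirDeriv v (dirDeriv v u) z ^ 2),
      Finset.mul_sum]
    refine Finset.sum_le_sum fun i _ => ?_
    rw [← hx i]
    unfold leviForm
    have := mul_nonneg (hw i) (sq_nonneg (dirDeriv (e i) (dirDeriv (e i) u) z -
      dirDeriv (Complex.I • e i) (dirDeriv (Complex.I • e i) u) z))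
    change 4 * (w i * _) ≤ w i * _ + w i * _
    change 0 ≤ w i * _ at this
    nlinarith
  have h3 : -(4 * Real.exp (g z) * (gradSq u z / v + v * gradSq g z)) ≤
      ∑ d : Fin n × Bool, w d.1 * (1 / 2 * ∑ d', dirDeriv (realFrame e d') u z *
        dirDeriv (realFrame e d) (dirDeriv (realFrame e d) (dirDeriv (realFrame e d') u)) z) := by
    have h4 : ∑ d : Fin n × Bool, w d.1 * (1 / 2 * ∑ d', dirDeriv (realFrame e d') u z *
        dirDeriv (realFrame e d) (dirDeriv (realFrame e d) (dirDeriv (realFrame e d') u)) z) =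
        ∑ d', 2 * (dirDeriv (realFrame e d') u z *
          (Real.exp (g z) * dirDeriv (realFrame e d') g z)) := by
      simp only [Finset.mul_sum]
      rw [Finset.sum_comm]
      refine Finset.sum_congr rfl fun d' _ => ?_
      have h5 := (differentiated_equation hu hg.exp hm heq (Real.exp_pos _) hdiag hcone d'.1
        (realFrame e d')).1
      rw [dirDeriv_exp hg] at h5
      beta_reduce at h5
      rw [h5, show ∀ a b : ℝ, 2 * (a * b) = 1 / 2 * a * (4 * b) by intros; ring,
        ← sum_mul_dirDeriv_dirDeriv e w z, Finset.mul_sum]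
      exact Finset.sum_congr rfl fun d _ => by ring
    rw [h4, gradSq_eq_sum_realFrame hu e, gradSq_eq_sum_realFrame hg e]
    have h6 : -(4 * Real.exp (g z) * (1 / 4 * ∑ d, dirDeriv (realFrame e d) u z ^ 2 / v +
        v * (1 / 4 * ∑ d, dirDeriv (realFrame e d) g z ^ 2))) =
        ∑ d, -(Real.exp (g z) * (dirDeriv (realFrame e d) u z ^ 2 / v +
          v * dirDeriv (realFrame e d) g z ^ 2)) := by
      rw [Finset.sum_neg_distrib, ← Finset.mul_sum, Finset.sum_add_distrib, ← Finset.mul_sum]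
      ring
    -- Young's inequality with weight `v`; in the application `v = -u`, which gives both terms the
    -- homogeneity `(-u)^(n/(n-k))`.
    have h7 : ∀ d, -(Real.exp (g z) * (dirDeriv (realFrame e d) u z ^ 2 / v +
          v * dirDeriv (realFrame e d) g z ^ 2)) ≤ 2 * (dirDeriv (realFrame e d) u z *
          (Real.exp (g z) * dirDeriv (realFrame e d) g z)) := by
      intro d
      have h8 : 0 ≤ Real.exp (g z) * ((dirDeriv (realFrame e d) u z +
          v * dirDeriv (realFrame e d) g z) ^ 2 / v) := by positivity
      have h9 : (dirDeriv (realFrame e d) u z + v * dirDeriv (realFrame e d) g z) ^ 2 / v =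
          dirDeriv (realFrame e d) u z ^ 2 / v + 2 * (dirDeriv (realFrame e d) u z *
            dirDeriv (realFrame e d) g z) + v * dirDeriv (realFrame e d) g z ^ 2 := by
        field_simp
        ring
      rw [h9] at h8
      linarith
    refine le_trans (le_of_eq ?_) (Finset.sum_le_sum fun d _ => h7 d)
    rw [← h6, ← Finset.sum_div]
    ring
  have h10 : ∑ d : Fin n × Bool, w d.1 *
      dirDeriv (realFrame e d) (dirDeriv (realFrame e d) (gradSq u)) z =
      ∑ d : Fin n × Bool, w d.1 *
      (1 / 2 * ∑ d', dirDeriv (realFrame e d) (dirDeriv (realFrame e d') u) z ^ 2) +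
      ∑ d : Fin n × Bool, w d.1 * (1 / 2 * ∑ d', dirDeriv (realFrame e d') u z *
        dirDeriv (realFrame e d) (dirDeriv (realFrame e d) (dirDeriv (realFrame e d') u)) z) := by
    rw [← Finset.sum_add_distrib]
    refine Finset.sum_congr rfl fun d _ => ?_
    rw [hG, Finset.sum_add_distrib]
    ring
  rw [h10]
  linarith

theorem sub_pos_of_lt {k n : ℕ} (h : k < n) : (0 : ℝ) < (n : ℝ) - k :=
  sub_pos.2 (by exact_mod_cast h)

theorem expA_eq {k : ℕ} (h : k < n) : expA n k = (n : ℝ) / ((n : ℝ) - k) + 1 := by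
  have := sub_pos_of_lt h
  unfold expA
  field_simp
  ring

/-- The interior estimate at a maximum point of the test function. -/
theorem interior_estimate {m : ℕ} (hkn : m + 1 < n) {σ : ℝ} (hσ : 0 < σ)
    (hσa : 8 * expA n (m + 1) ^ 2 * σ ≤ expA n (m + 1) - 1)
    {u g : Cn n → ℝ} (hu : ContDiff ℝ ∞ u) (hg : ContDiff ℝ ∞ g) {z : Cn n} (huz : u z < 0)
    (hsub : ∀ i, 1 ≤ i → i ≤ m + 1 → 0 ≤ hessOp i u z)
    (heq : ∀ᶠ w in 𝓝 z, hessOp (m + 1) u w = Real.exp (g w)) {M N₁ K₀ K₁ K₂ : ℝ}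
    (hN : 1 ≤ M - auxP (m + 1) u z) (hN₁ : M - auxP (m + 1) u z ≤ N₁)
    (hPN : auxP (m + 1) u z ≤ M - auxP (m + 1) u z) (hK₀ : auxP (m + 1) u z ≤ K₀)
    (hK₁ : (-u z) ^ (-(((m + 1 : ℕ) : ℝ) / ((n : ℝ) - (m + 1 : ℕ)))) * gradSq g z ≤ K₁)
    (hK₂ : (-u z) ^ (-(((m + 1 : ℕ) : ℝ) / ((n : ℝ) - (m + 1 : ℕ)))) *
      ‖iteratedFDeriv ℝ 2 g z‖ ≤ K₂) {ξ₀ : Cn n} (hξ₀ : ‖ξ₀‖ = 1)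
    (hmax : ∀ᶠ w in 𝓝 z, ∀ ξ : Cn n, ‖ξ‖ = 1 →
      levi u w ξ * (-u w) ^ (-((n : ℝ) / ((n : ℝ) - (m + 1 : ℕ)))) *
        (M - auxP (m + 1) u w) ^ (-σ) ≤
      levi u z ξ₀ * (-u z) ^ (-((n : ℝ) / ((n : ℝ) - (m + 1 : ℕ)))) *
        (M - auxP (m + 1) u z) ^ (-σ)) :
    levi u z ξ₀ * (-u z) ^ (-((n : ℝ) / ((n : ℝ) - (m + 1 : ℕ)))) *
        (M - auxP (m + 1) u z) ^ (-σ) ≤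
      eigenvalueBound ((n : ℝ) / ((n : ℝ) - (m + 1 : ℕ))) σ (((m : ℝ) + 1) / n) K₀ K₁ K₂ N₁ := by
  have hnk := sub_pos_of_lt hkn
  have hn0 : (0 : ℝ) < n := by exact_mod_cast (show 0 < n by omega)
  have hae := expA_eq hkn
  set b : ℝ := (n : ℝ) / ((n : ℝ) - (m + 1 : ℕ)) with hbdef
  set a : ℝ := expA n (m + 1) with hadef
  set v : ℝ := -u z with hvdef
  have hv : 0 < v := by linarith
  have hb : 1 < b := by
    rw [hbdef, lt_div_iff₀ hnk]
    push_cast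
    have : (0 : ℝ) ≤ m := Nat.cast_nonneg m
    linarith
  have hkb : ((m + 1 : ℕ) : ℝ) / ((n : ℝ) - (m + 1 : ℕ)) = b - 1 := by
    rw [hbdef]
    field_simp
    ring
  rw [hkb] at hK₁ hK₂
  set P : ℝ := auxP (m + 1) u z with hPdef
  set N : ℝ := M - P with hNdef
  have hN0 : 0 < N := by linarith
  have hP0 : 0 ≤ P := mul_nonneg (gradSq_nonneg u z) (Real.rpow_nonneg hv.le _)
  -- Since `a = b + 1` and `k/(n-k) = b - 1`, every power of `-u` in the estimate is `y`, `y * v` or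
  -- `y / v`.
  set y : ℝ := v ^ b with hydef
  have hy : 0 < y := Real.rpow_pos_of_pos hv b
  have hva : v ^ (-a) = (y * v)⁻¹ := by
    rw [hae, Real.rpow_neg hv.le, Real.rpow_add_one hv.ne']
  have hvb : v ^ (-b) = y⁻¹ := Real.rpow_neg hv.le b
  have hvk : v ^ (-(b - 1)) = (y / v)⁻¹ := by
    rw [Real.rpow_neg hv.le, Real.rpow_sub_one hv.ne']
  have hyv : 0 < y / v := div_pos hy hv
  rw [hvk, inv_mul_le_iff₀ hyv] at hK₁ hK₂
  have hK₁0 : 0 ≤ K₁ := by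
    have := (gradSq_nonneg g z).trans hK₁
    exact nonneg_of_mul_nonneg_right this hyv
  have hK₂0 : 0 ≤ K₂ := by
    have := (norm_nonneg _).trans hK₂
    exact nonneg_of_mul_nonneg_right this hyv
  obtain ⟨e, x, hdiag⟩ := exists_hessMat_eq_diagonal hu z
  have : Nonempty (Fin n) := ⟨⟨0, by omega⟩⟩
  obtain ⟨o, ho⟩ := Finite.exists_max x
  have hesym : ∀ j ≤ n, esym Finset.univ j x = hessOp j u z := fun j hj => by
    rw [hessOp_eq_minorSum hu z e hj, hdiag, minorSum_diagonal]
    simp [esym, ← Complex.ofReal_prod, ← Complex.ofReal_sum]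
  have hcone : ClosedCone Finset.univ (m + 1) x := by
    intro j hj
    rcases Nat.eq_zero_or_pos j with rfl | hj0
    · simp [esym_zero]
    · rw [hesym j (by omega)]
      exact hsub j hj0 hj
  have hf0 := Real.exp_pos (g z)
  have hfx : esym Finset.univ (m + 1) x = Real.exp (g z) := by
    rw [hesym _ hkn.le, heq.self_of_nhds]
  have hcard : (Finset.univ : Finset (Fin n)).card = n := by simp
  set w : Fin n → ℝ := fun i => esym (Finset.univ.erase i) m x with hwdef
  have hw : ∀ i, 0 ≤ w i := fun i =>
    hcone.erase (by omega) (Finset.mem_univ i) m le_rfl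
  have hlow := hcone.mul_esym_le_card_mul (by omega) (Finset.mem_univ o) fun j _ => ho j
  rw [hfx, hcard] at hlow
  have hxo : 0 < x o := by
    have h1 : 0 < ((m : ℝ) + 1) * Real.exp (g z) := by positivity
    have h2 := pos_of_mul_pos_right (h1.trans_le hlow) hn0.le
    exact pos_of_mul_pos_left h2 (hw o)
  have hlo : leviForm u (e o) z = x o := by
    have := congrFun (congrFun hdiag o) o
    rw [hessMat, Matrix.of_apply, hessForm_self hu, Matrix.diagonal_apply_eq] at this
    exact_mod_cast this
  have hlevi : levi u z ξ₀ ≤ x o := levi_le_of_hessMat_eq_diagonal hu hdiag ho hξ₀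
  have hGs : ContDiff ℝ ∞ (gradSq u) := by
    rw [gradSq_eq_sum_realFrame hu e]
    exact contDiff_const.mul (ContDiff.sum fun d _ => (hu.dirDeriv _).pow 2)
  have hLs := contDiff_leviForm hu (e o)
  -- The value `0` at `i = o` reflects that no third order term is available there; the relation `w
  -- i - x o * S i = w o - x i * S i` then holds for all `i`.
  set S : Fin n → ℝ := fun i =>
    if i = o then 0 else esymPred ((Finset.univ.erase o).erase i) m x with hSdef
  have hbound : x o ≤ eigenvalueBound b σ (((m : ℝ) + 1) / n) K₀ K₁ K₂ N₁ * y := by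
    -- The varying direction is frozen at the eigenvector `e o`, which at `z` does at least as well
    -- as `ξ₀`.
    have hline : ∀ d : Cn n, IsLocalMax (fun t : ℝ => leviForm u (e o) (z + t • d) *
        (-u (z + t • d)) ^ (-b) *
        (M - gradSq u (z + t • d) * (-u (z + t • d)) ^ (-a)) ^ (-σ)) 0 := by
      intro d
      have hc : Filter.Tendsto (fun t : ℝ => z + t • d) (𝓝 0) (𝓝 z) := by
        have : ContinuousAt (fun t : ℝ => z + t • d) 0 := by fun_prop
        simpa [ContinuousAt] using this
      filter_upwards [hc.eventually hmax] with t ht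
      have h1 := ht (e o) (by simp)
      rw [levi_eq_leviForm hu] at h1
      refine h1.trans ?_
      simp only [zero_smul, add_zero, hlo]
      change levi u z ξ₀ * v ^ (-b) * N ^ (-σ) ≤ x o * v ^ (-b) * N ^ (-σ)
      gcongr
    have htest := fun d : Fin n × Bool => test_function_conditions (a := a) (b := b) (σ := σ)
      (M := M)
      (hasDerivAt_line hLs z (realFrame e d)) (hasDerivAt_line hu z (realFrame e d))
      (hasDerivAt_line hGs z (realFrame e d))
      (hasDerivAt_line (hLs.dirDeriv _) z (realFrame e d) 0)
      (hasDerivAt_line (hu.dirDeriv _) z (realFrame e d) 0)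
      (hasDerivAt_line (hGs.dirDeriv _) z (realFrame e d) 0)
      (by simpa [hlo] using hxo) (by simpa using huz)
      (by simp only [zero_smul, add_zero]; exact hN0) (hline (realFrame e d))
      (P := P) (N := N) (U := dirDeriv (realFrame e d) u z / v)
      (p := v ^ (-a) * dirDeriv (realFrame e d) (gradSq u) z +
        a * P * (dirDeriv (realFrame e d) u z / v))
      (by simp only [zero_smul, add_zero]; rfl) rfl (by simp only [zero_smul, add_zero]; rfl)
      (by simp only [zero_smul, add_zero]; rfl)
    simp only [zero_smul, add_zero, hlo] at htest
    rw [← hvdef, hva] at htest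
    -- From `a ^ 2 ≥ 4 (a - 1)` and the hypothesis on `σ`, even `32 σ ≤ 1`.
    have h8 : 4 * σ ≤ 1 := by
      nlinarith [sq_nonneg (a - 2)]
    refine eigenvalue_le_of_test_conditions o (fun d : Fin n × Bool => d.1) (w := w) (l := x)
      (S := S) (f := Real.exp (g z)) (P := P) (N := N) (v := v)
      (U := fun d => dirDeriv (realFrame e d) u z / v)
      (L₁ := fun d => dirDeriv (realFrame e d) (leviForm u (e o)) z)
      (L₂ := fun d => dirDeriv (realFrame e d) (dirDeriv (realFrame e d) (leviForm u (e o))) z)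
      (u₂ := fun d => dirDeriv (realFrame e d) (dirDeriv (realFrame e d) u) z)
      (G₂ := fun d => dirDeriv (realFrame e d) (dirDeriv (realFrame e d) (gradSq u)) z)
      (by linarith) hσ (by linarith) (by linarith) h8 (by positivity) (hP0.trans hK₀) hK₁0 hK₂0 hN
      hN₁ hP0 hPN hy hv hf0 hxo hw ?_ ?_ ?_ (fun d => (htest d).1) (fun d => (htest d).2)
      ?_ ?_ ?_ ?_
    · intro i
      simp only [hSdef]
      split_ifs with h
      · exact le_rfl
      · exact hcone.esymPred_erase_nonneg (by simpa using hkn.le) h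
    · intro i
      simp only [hSdef]
      split_ifs with h
      · rw [h]
      · have h1 := esym_erase_pred (s := Finset.univ.erase i) (i := o)
          (by simp [Ne.symm h]) m x
        have h2 := esym_erase_pred (s := Finset.univ.erase o) (i := i) (by simp [h]) m x
        rw [Finset.erase_right_comm] at h1
        simp only [hwdef]
        rw [h1, h2]
        ring
    · have h1 : w o * x o ^ 2 ≤ ∑ i, w i * x i ^ 2 :=
        Finset.single_le_sum (f := fun i => w i * x i ^ 2)
          (fun i _ => mul_nonneg (hw i) (sq_nonneg _)) (Finset.mem_univ o)
      refine le_trans ?_ h1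
      rw [div_mul_eq_mul_div, div_mul_eq_mul_div, div_le_iff₀ hn0]
      have := mul_le_mul_of_nonneg_right hlow hxo.le
      change _ ≤ (n : ℝ) * (x o * w o) * x o at this
      linarith
    · have h1 : gradSq u z = P * (y * v) := by
        rw [hPdef, auxP, ← hadef, ← hvdef, hva]
        field_simp
      have h2 : ∑ d, (dirDeriv (realFrame e d) u z / v) ^ 2 = 4 * (P * (y * v)) / v ^ 2 := by
        rw [← h1, gradSq_eq_sum_realFrame hu e]
        simp only [div_pow]
        rw [← Finset.sum_div]
        ring
      rw [h2]
      have h3 : 4 * (P * (y * v)) / v ^ 2 = 4 * P * (y / v) := by field_simp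
      rw [h3]
      gcongr
    · rw [sum_mul_dirDeriv_dirDeriv e w z]
      have h1 : ∑ i, leviForm u (e i) z * w i = ((m : ℝ) + 1) * Real.exp (g z) := by
        rw [← hfx, ← sum_mul_esym_erase]
        refine Finset.sum_congr rfl fun i _ => ?_
        have := congrFun (congrFun hdiag i) i
        rw [hessMat, Matrix.of_apply, hessForm_self hu, Matrix.diagonal_apply_eq] at this
        rw [show leviForm u (e i) z = x i by exact_mod_cast this]
      rw [h1]
      positivity
    · have h1 := linearized_leviForm_ge hu hg.exp hkn.le heq hf0 hdiag hcone o
      rw [dirDeriv_dirDeriv_exp hg, dirDeriv_dirDeriv_exp hg] at h1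
      have h2 : ∀ d : Cn n, ‖d‖ = 1 → -(K₂ * (y / v)) ≤ dirDeriv d (dirDeriv d g) z := by
        intro d hd
        have h3 := (abs_le.1 (abs_dirDeriv_dirDeriv_le hg hd z)).1
        linarith
      have h3 := mul_le_mul_of_nonneg_left (h2 (e o) (by simp)) hf0.le
      have h4 := mul_le_mul_of_nonneg_left (h2 (Complex.I • e o) (by simp [norm_smul])) hf0.le
      rw [sum_realFrame e fun i d => w i * dirDeriv d (dirDeriv d (leviForm u (e o))) z,
        sum_realFrame e fun i d => S i * dirDeriv d (leviForm u (e o)) z ^ 2]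
      simp only [← mul_add]
      have h5 : ∑ i, S i * (dirDeriv (e i) (leviForm u (e o)) z ^ 2 +
          dirDeriv (Complex.I • e i) (leviForm u (e o)) z ^ 2) =
          ∑ i ∈ Finset.univ.erase o, esymPred ((Finset.univ.erase o).erase i) m x *
          (dirDeriv (e i) (leviForm u (e o)) z ^ 2 +
          dirDeriv (Complex.I • e i) (leviForm u (e o)) z ^ 2) := by
        rw [← Finset.add_sum_erase _ _ (Finset.mem_univ o)]
        simp only [hSdef, if_true, zero_mul, zero_add]
        refine Finset.sum_congr rfl fun i hi => ?_
        rw [if_neg (Finset.ne_of_mem_erase hi)]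
      rw [h5]
      linarith
    · refine le_trans ?_ (linearized_gradSq_ge hu hg hkn.le heq hdiag hcone hw hv)
      have h1 : gradSq u z = P * (y * v) := by
        rw [hPdef, auxP, ← hadef, ← hvdef, hva]
        field_simp
      have h2 : gradSq u z / v ≤ K₀ * y := by
        rw [h1, show P * (y * v) / v = P * y by field_simp]
        gcongr
      have h3 : v * gradSq g z ≤ K₁ * y := by
        calc v * gradSq g z ≤ v * (y / v * K₁) := by gcongr
          _ = K₁ * y := by field_simp
      have h4 : Real.exp (g z) * (gradSq u z / v + v * gradSq g z) ≤
          Real.exp (g z) * (K₀ * y + K₁ * y) := by gcongr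
      linarith
  have hNσ : N ^ (-σ) ≤ 1 := Real.rpow_le_one_of_one_le_of_nonpos hN (by linarith)
  have hNσ0 : 0 ≤ N ^ (-σ) := Real.rpow_nonneg hN0.le _
  rw [hvb]
  calc levi u z ξ₀ * y⁻¹ * N ^ (-σ) ≤ x o * y⁻¹ * N ^ (-σ) := by gcongr
    _ ≤ x o * y⁻¹ * 1 := mul_le_mul_of_nonneg_left hNσ (by positivity)
    _ ≤ _ := by
      rw [mul_one, ← div_eq_mul_inv, div_le_iff₀ hy]
      exact hbound

/-! ### Localization -/

/-- Multiplication by a bump function. All quantities at a point depend only on the germ of `u`, so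
the calculus above may assume smoothness on the whole space. -/
theorem exists_contDiff_eventuallyEq {u : Cn n → ℝ} {U : Set (Cn n)} (hU : IsOpen U)
    (hu : ContDiffOn ℝ ∞ u U) {z : Cn n} (hz : z ∈ U) :
    ∃ v : Cn n → ℝ, ContDiff ℝ ∞ v ∧ v =ᶠ[𝓝 z] u := by
  obtain ⟨r, hr, hrU⟩ := Metric.isOpen_iff.1 hU z hz
  let χ : ContDiffBump z := ⟨r / 4, r / 2, by linarith, by linarith⟩
  refine ⟨fun w => χ w * u w, contDiff_iff_contDiffAt.2 fun w => ?_, ?_⟩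
  · by_cases hw : w ∈ U
    · exact χ.contDiff.contDiffAt.mul (hu.contDiffAt (hU.mem_nhds hw))
    · have hw' : w ∉ tsupport χ := by
        rw [χ.tsupport_eq]
        intro h
        exact hw (hrU (closedBall_subset_ball (by simp only [χ]; linarith) h))
      have h0 : (fun w => χ w * u w) =ᶠ[𝓝 w] fun _ => 0 := by
        filter_upwards [notMem_tsupport_iff_eventuallyEq.1 hw'] with y hy
        simp [hy]
      exact contDiffAt_const.congr_of_eventuallyEq h0
  · filter_upwards [χ.eventuallyEq_one] with w hw
    simp [hw]

theorem dz_congr {g h : Cn n → ℂ} {z : Cn n} (j : Fin n) (hgh : g =ᶠ[𝓝 z] h) :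
    dz j g =ᶠ[𝓝 z] dz j h := by
  filter_upwards [hgh.eventuallyEq_nhds] with w hw
  unfold dz
  rw [hw.fderiv_eq]

theorem dzbar_congr {g h : Cn n → ℂ} {z : Cn n} (j : Fin n) (hgh : g =ᶠ[𝓝 z] h) :
    dzbar j g =ᶠ[𝓝 z] dzbar j h := by
  filter_upwards [hgh.eventuallyEq_nhds] with w hw
  unfold dzbar
  rw [hw.fderiv_eq]

section Congr
variable {u v : Cn n → ℝ} {z : Cn n}

theorem toC_congr (h : u =ᶠ[𝓝 z] v) : toC u =ᶠ[𝓝 z] toC v :=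
  h.mono fun w hw => by simp [toC, hw]

theorem gradSq_congr (h : u =ᶠ[𝓝 z] v) : gradSq u z = gradSq v z :=
  Finset.sum_congr rfl fun j _ => by rw [(dz_congr j (toC_congr h)).self_of_nhds]

theorem cHess_congr (h : u =ᶠ[𝓝 z] v) : cHess u z = cHess v z := by
  ext i j
  exact (dz_congr i (dzbar_congr j (toC_congr h))).self_of_nhds

theorem levi_congr (h : u =ᶠ[𝓝 z] v) (ξ : Cn n) : levi u z ξ = levi v z ξ := by
  unfold levi
  rw [cHess_congr h]

theorem hessOp_congr (h : u =ᶠ[𝓝 z] v) (k : ℕ) : hessOp k u z = hessOp k v z := by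
  unfold hessOp
  rw [cHess_congr h]

theorem auxP_congr (h : u =ᶠ[𝓝 z] v) (k : ℕ) : auxP k u z = auxP k v z := by
  unfold auxP
  rw [gradSq_congr h, h.self_of_nhds]

end Congr

/-! ### Continuity -/

theorem continuous_gradSq {u : Cn n → ℝ} (hu : ContDiff ℝ ∞ u) : Continuous (gradSq u) := by
  rw [gradSq_eq_sum_realFrame hu (EuclideanSpace.basisFun (Fin n) ℂ)]
  exact continuous_const.mul (continuous_finsetSum _ fun d _ =>
    (hu.dirDeriv _).continuous.pow 2)

theorem continuous_leviForm {u : Cn n → ℝ} (hu : ContDiff ℝ ∞ u) :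
    Continuous fun q : Cn n × Cn n => leviForm u q.2 q.1 := by
  have h : Continuous (fderiv ℝ (fderiv ℝ u)) :=
    ((hu.fderiv_right (m := ∞) (by simp)).fderiv_right (m := ∞) (by simp)).continuous
  unfold leviForm
  simp only [dirDeriv_dirDeriv hu]
  fun_prop

theorem continuousAt_auxP {u : Cn n → ℝ} {U : Set (Cn n)} (hU : IsOpen U)
    (hu : ContDiffOn ℝ ∞ u U) (k : ℕ) {z : Cn n} (hz : z ∈ U) (hneg : u z < 0) :
    ContinuousAt (auxP k u) z := by
  obtain ⟨v, hv, hvu⟩ := exists_contDiff_eventuallyEq hU hu hz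
  have h1 : auxP k v =ᶠ[𝓝 z] auxP k u :=
    hvu.eventuallyEq_nhds.mono fun w hw => auxP_congr hw k
  refine ContinuousAt.congr ?_ h1
  have hvz : v z < 0 := by rwa [hvu.self_of_nhds]
  exact (continuous_gradSq hv).continuousAt.mul
    (hv.continuous.continuousAt.neg.rpow_const (Or.inl (neg_ne_zero.2 hvz.ne)))

theorem continuousAt_levi {u : Cn n → ℝ} {U : Set (Cn n)} (hU : IsOpen U)
    (hu : ContDiffOn ℝ ∞ u U) {z : Cn n} (hz : z ∈ U) (ξ : Cn n) :
    ContinuousAt (fun q : Cn n × Cn n => levi u q.1 q.2) (z, ξ) := by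
  obtain ⟨v, hv, hvu⟩ := exists_contDiff_eventuallyEq hU hu hz
  refine (continuous_leviForm hv).continuousAt.congr ?_
  filter_upwards [continuousAt_fst.eventually hvu.eventuallyEq_nhds] with q hq
  rw [← levi_congr hq, levi_eq_leviForm hv]

/-! ### Negativity of solutions -/

theorem IsLocalMax.dirDeriv_dirDeriv_nonpos {g : Cn n → ℝ} (hg : ContDiff ℝ ∞ g) {z : Cn n}
    (hmax : IsLocalMax g z) (d : Cn n) : dirDeriv d (dirDeriv d g) z ≤ 0 := by
  have hc : Filter.Tendsto (fun t : ℝ => z + t • d) (𝓝 0) (𝓝 z) := by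
    have : ContinuousAt (fun t : ℝ => z + t • d) 0 := by fun_prop
    simpa [ContinuousAt] using this
  have hl : IsLocalMax (fun t : ℝ => g (z + t • d)) 0 := by
    filter_upwards [hc.eventually hmax] with t ht
    simpa using ht
  have := (hl.second_derivative_nonpos (Filter.Eventually.of_forall (hasDerivAt_line hg z d))
    (hasDerivAt_line (hg.dirDeriv d) z d 0)).2
  simpa using this

theorem hessOp_one_eq_sum_levi (u : Cn n → ℝ) (z : Cn n) :
    hessOp 1 u z = ∑ i, levi u z (unitVec i) := by
  have h1 : ∀ s : Multiset ℂ, s.esymm 1 = s.sum := fun s => by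
    simp [Multiset.esymm, Multiset.powersetCard_one]
  unfold hessOp
  rw [h1, ← Matrix.trace_eq_sum_roots_charpoly, Matrix.trace, Complex.re_sum]
  refine Finset.sum_congr rfl fun i _ => ?_
  unfold levi
  simp [unitVec]

/-- A subharmonic function which is negative on the boundary is negative. -/
theorem neg_of_neg_on_frontier (hn : 0 < n) {u : Cn n → ℝ} {S U : Set (Cn n)} (hS : IsOpen S)
    (hSb : Bornology.IsBounded S) (hU : IsOpen U) (hSU : closure S ⊆ U)
    (hu : ContDiffOn ℝ ∞ u U) (hsub : ∀ z ∈ S, 0 ≤ hessOp 1 u z)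
    (hfr : ∀ z ∈ frontier S, u z < 0) : ∀ z ∈ closure S, u z < 0 := by
  have hcomp : IsCompact (closure S) := hSb.isCompact_closure
  obtain ⟨ρ, hρ0, hρ⟩ := hcomp.isBounded.exists_pos_norm_le
  -- The square of `ℓ = Re z_0` has positive Laplacian. Adding `η * ℓ ^ 2` makes `u` strictly
  -- subharmonic and excludes an interior maximum.
  let ℓ : Cn n →L[ℝ] ℝ := Complex.reCLM.comp
    ((EuclideanSpace.proj (⟨0, hn⟩ : Fin n) : Cn n →L[ℂ] ℂ).restrictScalars ℝ)
  have hℓ : ∀ z, ℓ z = (z ⟨0, hn⟩).re := fun z => rfl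
  have hℓle : ∀ z ∈ closure S, ℓ z ^ 2 ≤ ρ ^ 2 := by
    intro z hz
    rw [hℓ]
    have h1 := (Complex.abs_re_le_norm (z ⟨0, hn⟩)).trans
      ((PiLp.norm_apply_le z ⟨0, hn⟩).trans (hρ z hz))
    rw [← sq_abs]
    exact pow_le_pow_left₀ (abs_nonneg _) h1 2
  have hcu : ContinuousOn u (closure S) := hu.continuousOn.mono hSU
  have key : ∀ η : ℝ, 0 < η → ∀ z ∈ closure S, ∃ z' ∈ frontier S, u z ≤ u z' + η * ρ ^ 2 := by
    intro η hη z hz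
    obtain ⟨z', hz', hmax⟩ := hcomp.exists_isMaxOn ⟨z, hz⟩
      (hcu.add (continuousOn_const.mul (ℓ.continuous.pow 2).continuousOn) :
        ContinuousOn (fun z => u z + η * ℓ z ^ 2) (closure S))
    refine ⟨z', ?_, ?_⟩
    · rw [hS.frontier_eq]
      refine ⟨hz', fun hz'S => ?_⟩
      obtain ⟨v, hv, hvu⟩ := exists_contDiff_eventuallyEq hU hu (hSU hz')
      have hq : ContDiff ℝ ∞ fun z => ℓ z * ℓ z := ℓ.contDiff.mul ℓ.contDiff
      have hloc : IsLocalMax (fun z => v z + η * (ℓ z * ℓ z)) z' := by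
        filter_upwards [hvu, hS.mem_nhds hz'S] with w hw hwS
        have : u w + η * ℓ w ^ 2 ≤ u z' + η * ℓ z' ^ 2 := hmax (subset_closure hwS)
        rw [hw, hvu.self_of_nhds, ← sq, ← sq]
        exact this
      have hdℓ : ∀ d, dirDeriv d ℓ = fun _ => ℓ d := fun d => by
        ext w
        unfold dirDeriv
        rw [ℓ.fderiv]
      have hdd : ∀ d, dirDeriv d (dirDeriv d fun z => v z + η * (ℓ z * ℓ z)) z' =
          dirDeriv d (dirDeriv d v) z' + η * (2 * ℓ d ^ 2) := by
        intro d
        have hc : ContDiff ℝ ∞ fun z => ℓ z * ℓ d + ℓ d * ℓ z :=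
          (ℓ.contDiff.mul contDiff_const).add (contDiff_const.mul ℓ.contDiff)
        rw [dirDeriv_add hv (contDiff_const.mul hq), dirDeriv_const_mul hq,
          dirDeriv_mul ℓ.contDiff ℓ.contDiff, hdℓ,
          dirDeriv_add (hv.dirDeriv d) (contDiff_const.mul hc), dirDeriv_const_mul hc]
        have e : (fun z => ℓ z * ℓ d + ℓ d * ℓ z) = fun z => (2 * ℓ d) * ℓ z := by
          ext z; ring
        rw [e, dirDeriv_const_mul ℓ.contDiff, hdℓ]
        ring
      have hle : ∀ d, dirDeriv d (dirDeriv d v) z' ≤ -(η * (2 * ℓ d ^ 2)) := fun d => by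
        have := IsLocalMax.dirDeriv_dirDeriv_nonpos
          (hv.add (contDiff_const.mul hq)) hloc d
        rw [hdd] at this
        linarith
      have htr := hsub z' hz'S
      rw [← hessOp_congr hvu, hessOp_one_eq_sum_levi] at htr
      have hterm : ∀ i : Fin n, levi v z' (unitVec i) ≤ -(1 / 2 * η * ℓ (unitVec i) ^ 2) := by
        intro i
        rw [levi_eq_leviForm hv]
        unfold leviForm
        have h1 := hle (unitVec i)
        have h2 := hle (Complex.I • unitVec i)
        have h3 : 0 ≤ η * (2 * ℓ (Complex.I • unitVec i) ^ 2) := by positivity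
        linarith
      have h1 := Finset.sum_le_sum fun i (_ : i ∈ Finset.univ) => hterm i
      have h2 : ∑ i : Fin n, -(1 / 2 * η * ℓ (unitVec i) ^ 2) ≤
          -(1 / 2 * η * ℓ (unitVec ⟨0, hn⟩) ^ 2) := by
        rw [Finset.sum_neg_distrib, neg_le_neg_iff]
        exact Finset.single_le_sum (f := fun i : Fin n => 1 / 2 * η * ℓ (unitVec i) ^ 2)
          (fun i _ => by positivity) (Finset.mem_univ _)
      have h3 : ℓ (unitVec ⟨0, hn⟩) = 1 := by rw [hℓ]; simp [unitVec]
      rw [h3] at h2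
      linarith
    · have h1 : u z + η * ℓ z ^ 2 ≤ u z' + η * ℓ z' ^ 2 := hmax hz
      have h2 := mul_le_mul_of_nonneg_left (hℓle z' hz') hη.le
      have h3 : 0 ≤ η * ℓ z ^ 2 := by positivity
      linarith
  intro z hz
  obtain ⟨z₁, hz₁, -⟩ := key 1 one_pos z hz
  obtain ⟨z₀, hz₀, hmax⟩ := (hcomp.of_isClosed_subset isClosed_frontier
    frontier_subset_closure).exists_isMaxOn ⟨z₁, hz₁⟩ (hcu.mono frontier_subset_closure)
  have hz₀n := hfr z₀ hz₀
  -- With this `η` the error `η * ρ ^ 2` is half the distance of the frontier maximum from `0`.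
  obtain ⟨z₂, hz₂, h2⟩ := key (-u z₀ / (2 * ρ ^ 2)) (div_pos (by linarith) (by positivity)) z hz
  have h3 : -u z₀ / (2 * ρ ^ 2) * ρ ^ 2 = -u z₀ / 2 := by field_simp
  have h4 : u z₂ ≤ u z₀ := hmax hz₂
  linarith

/-! ### The data -/

theorem fEps_pos {k : ℕ} (hk : 1 ≤ k) (hkn : k < n) {ε : ℝ} (hε : 0 < ε) (z : Cn n) :
    0 < fEps n k ε z := by
  have h1 : (0 : ℝ) < n.choose k := by exact_mod_cast Nat.choose_pos hkn.le
  have hk0 : (0 : ℝ) < k := by exact_mod_cast hk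
  have h2 : 0 < (n : ℝ) / k - 1 := by
    rw [sub_pos, lt_div_iff₀ hk0, one_mul]
    exact_mod_cast hkn
  unfold fEps
  positivity

theorem contDiff_logf {k : ℕ} (hk : 1 ≤ k) (hkn : k < n) {ε : ℝ} (hε : 0 < ε) :
    ContDiff ℝ ∞ (logf n k ε : Cn n → ℝ) := by
  refine ContDiff.log ?_ fun z => (fEps_pos hk hkn hε z).ne'
  refine contDiff_const.div (((contDiff_norm_sq ℂ).add contDiff_const).pow _) fun z => ?_
  positivity

theorem wEps_neg {k : ℕ} {ε : ℝ} (hε : 0 < ε) (z : Cn n) : wEps n k ε z < 0 := by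
  unfold wEps
  have : 0 < ((‖z‖ ^ 2 + ε ^ 2) / (1 + ε ^ 2)) ^ (1 - (n : ℝ) / (k : ℝ)) :=
    Real.rpow_pos_of_pos (by positivity) _
  linarith

theorem isOpen_Sig (Ω : Set (Cn n)) (R : ℝ) : IsOpen (Sig Ω R) :=
  isOpen_ball.sdiff isClosed_closure

theorem frontier_Sig_subset {Ω : Set (Cn n)} (hΩ : IsOpen Ω) (R : ℝ) :
    frontier (Sig Ω R) ⊆ frontier Ω ∪ sphere 0 R := by
  intro z hz
  rw [(isOpen_Sig Ω R).frontier_eq] at hz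
  obtain ⟨hz1, hz2⟩ := hz
  have hcl : z ∈ closedBall (0 : Cn n) R :=
    closure_minimal (sdiff_subset.trans ball_subset_closedBall) isClosed_closedBall hz1
  by_cases hb : z ∈ ball (0 : Cn n) R
  · left
    have hzc : z ∈ closure Ω := by
      by_contra h
      exact hz2 ⟨hb, h⟩
    rw [hΩ.frontier_eq]
    refine ⟨hzc, fun hzΩ => ?_⟩
    have hd : Disjoint Ω (Sig Ω R) :=
      Set.disjoint_left.2 fun w hw hw' => hw'.2 (subset_closure hw)
    exact Set.disjoint_left.1 (hd.closure_right hΩ) hzΩ hz1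
  · right
    rw [mem_closedBall] at hcl
    rw [mem_ball, not_lt] at hb
    exact le_antisymm hcl hb

/-- The whole space is connected, and the region is neither empty nor everything, as it misses the
origin. -/
theorem frontier_Sig_nonempty {n : ℕ} {Ω : Set (Cn n)} {R : ℝ} (h0 : (0 : Cn n) ∈ Ω)
    (hne : (closure (Sig Ω R)).Nonempty) : (frontier (Sig Ω R)).Nonempty := by
  rw [Set.nonempty_iff_ne_empty, Ne, ← isClopen_iff_frontier_eq_empty, isClopen_iff]
  rintro (h | h)
  · exact (closure_nonempty_iff.1 hne).ne_empty h
  · have : (0 : Cn n) ∈ Sig Ω R := h ▸ mem_univ _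
    exact this.2 (subset_closure h0)

/-- The trace of the complex Hessian is nonnegative up to the closure by continuity, so some
coordinate direction has a nonnegative Levi value. On the frontier this yields a nonnegative value
of `H`. -/
theorem exists_unit_levi_nonneg {n : ℕ} (hn : 0 < n) {u : Cn n → ℝ} {S U : Set (Cn n)}
    (hU : IsOpen U) (hSU : closure S ⊆ U) (hu : ContDiffOn ℝ ∞ u U)
    (hsub : ∀ z ∈ S, 0 ≤ hessOp 1 u z) {z : Cn n} (hz : z ∈ closure S) :
    ∃ ξ : Cn n, ‖ξ‖ = 1 ∧ 0 ≤ levi u z ξ := by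
  have hc : ContinuousAt (fun w => ∑ i, levi u w (unitVec i)) z := by
    refine tendsto_finsetSum _ fun i _ => ?_
    exact (continuousAt_levi hU hu (hSU hz) (unitVec i)).comp (f := fun w : Cn n => (w, unitVec i))
      (by fun_prop)
  have : (𝓝[S] z).NeBot := mem_closure_iff_nhdsWithin_neBot.1 hz
  have h0 : 0 ≤ ∑ i, levi u z (unitVec i) :=
    ge_of_tendsto (hc.mono_left nhdsWithin_le_nhds) (eventually_nhdsWithin_of_forall fun w hw => by
      rw [← hessOp_one_eq_sum_levi]
      exact hsub w hw)
  have : (Finset.univ : Finset (Fin n)).Nonempty := ⟨⟨0, hn⟩, Finset.mem_univ _⟩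
  obtain ⟨i, -, hi⟩ := Finset.exists_le_of_sum_le this
    (f := fun _ => (0 : ℝ)) (g := fun i => levi u z (unitVec i)) (by simpa using h0)
  exact ⟨unitVec i, by simp [unitVec], hi⟩

theorem exists_isMax_prod_sphere {E : Type*} [NormedAddCommGroup E] [ProperSpace E] {S : Set E}
    (hS : IsCompact S) {F : E → E → ℝ}
    (hF : ContinuousOn (fun q : E × E => F q.1 q.2) (S ×ˢ sphere 0 1)) {z ξ : E} (hz : z ∈ S)
    (hξ : ‖ξ‖ = 1) :
    ∃ z₀ ∈ S, ∃ ξ₀ : E, ‖ξ₀‖ = 1 ∧ ∀ w ∈ S, ∀ η : E, ‖η‖ = 1 → F w η ≤ F z₀ ξ₀ := by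
  have hs : ∀ η : E, η ∈ sphere (0 : E) 1 ↔ ‖η‖ = 1 := fun η => mem_sphere_zero_iff_norm
  obtain ⟨q, hq, hmax⟩ := (hS.prod (isCompact_sphere (0 : E) 1)).exists_isMaxOn
    ⟨(z, ξ), hz, (hs ξ).2 hξ⟩ hF
  exact ⟨q.1, hq.1, q.2, (hs _).1 hq.2, fun w hw η hη => hmax (Set.mk_mem_prod hw ((hs η).2 hη))⟩

end ExteriorHessian

/-! ### The global maximum argument -/

open ExteriorHessian in
theorem theorem4p4 (n k : ℕ) (hk : 1 ≤ k) (hkn : k < n)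
    (σ : ℝ) (hσ_pos : 0 < σ)
    (hσ : σ ≤ (ExteriorHessian.expA n k - 1) / (8 * ExteriorHessian.expA n k ^ 2))
    (K₀ K₁ K₂ : ℝ) :
    ∃ C : ℝ, 0 < C ∧
      ∀ (Ω : Set (ExteriorHessian.Cn n)) (R ε : ℝ) (u : ExteriorHessian.Cn n → ℝ),
        IsOpen Ω → (0 : ExteriorHessian.Cn n) ∈ Ω → closure Ω ⊆ Metric.ball 0 R → 0 < ε →
        ExteriorHessian.IsApproxSolution k Ω R ε u →
        (∀ z ∈ closure (ExteriorHessian.Sig Ω R), ExteriorHessian.auxP k u z ≤ K₀) →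
        (∀ z ∈ closure (ExteriorHessian.Sig Ω R),
          (-u z) ^ (-((k : ℝ) / ((n : ℝ) - k))) *
            ExteriorHessian.gradSq (ExteriorHessian.logf n k ε) z ≤ K₁) →
        (∀ z ∈ closure (ExteriorHessian.Sig Ω R),
          (-u z) ^ (-((k : ℝ) / ((n : ℝ) - k))) *
            ‖iteratedFDeriv ℝ 2 (ExteriorHessian.logf n k ε) z‖ ≤ K₂) →
        ∀ z ∈ closure (ExteriorHessian.Sig Ω R), ∀ ξ : ExteriorHessian.Cn n, ‖ξ‖ = 1 →
          ∃ z' ∈ frontier (ExteriorHessian.Sig Ω R), ∃ ξ' : ExteriorHessian.Cn n, ‖ξ'‖ = 1 ∧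
            ExteriorHessian.auxH k σ Ω R u z ξ ≤ C + ExteriorHessian.auxH k σ Ω R u z' ξ' := by
  obtain ⟨m, rfl⟩ : ∃ m, k = m + 1 := ⟨k - 1, by omega⟩
  set B := eigenvalueBound ((n : ℝ) / ((n : ℝ) - (m + 1 : ℕ))) σ (((m : ℝ) + 1) / n) K₀ K₁ K₂
    (2 * K₀ + 1) with hB
  refine ⟨max 1 B, lt_max_of_lt_left one_pos, ?_⟩
  intro Ω R ε u hΩ h0Ω hΩR hε hsol hP hg1 hg2 z hz ξ hξ
  obtain ⟨U, hU, hSU, hu⟩ := hsol.smooth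
  have hn : 0 < n := by omega
  have hSopen := isOpen_Sig Ω R
  have hSb : Bornology.IsBounded (Sig Ω R) := isBounded_ball.subset sdiff_subset
  have hcomp : IsCompact (closure (Sig Ω R)) := hSb.isCompact_closure
  have hsub1 : ∀ w ∈ Sig Ω R, 0 ≤ hessOp 1 u w := fun w hw =>
    hsol.subharmonic w hw 1 le_rfl (by omega)
  have hneg : ∀ w ∈ closure (Sig Ω R), u w < 0 := by
    refine neg_of_neg_on_frontier hn hSopen hSb hU hSU hu hsub1 fun w hw => ?_
    rcases frontier_Sig_subset hΩ R hw with h | h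
    · rw [hsol.inner_bdry w h]
      norm_num
    · rw [hsol.outer_bdry w h]
      exact wEps_neg hε w
  have ha : 0 < expA n (m + 1) := by
    rw [expA_eq hkn]
    have := sub_pos_of_lt hkn
    positivity
  have hPc : ContinuousOn (auxP (m + 1) u) (closure (Sig Ω R)) := fun w hw =>
    (continuousAt_auxP hU hu (m + 1) (hSU hw) (hneg w hw)).continuousWithinAt
  set s : ℝ := sSup (auxP (m + 1) u '' closure (Sig Ω R)) with hs
  have hM : auxM (m + 1) Ω R u = 2 * s + 1 := rfl
  have hPs : ∀ w ∈ closure (Sig Ω R), auxP (m + 1) u w ≤ s := fun w hw =>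
    le_csSup (hcomp.bddAbove_image hPc) (mem_image_of_mem _ hw)
  have hsK : s ≤ K₀ := by
    refine csSup_le ⟨_, mem_image_of_mem _ hz⟩ ?_
    rintro _ ⟨w, hw, rfl⟩
    exact hP w hw
  have hP0 : ∀ w ∈ closure (Sig Ω R), 0 ≤ auxP (m + 1) u w := fun w hw =>
    mul_nonneg (gradSq_nonneg u w) (Real.rpow_nonneg (by linarith [hneg w hw]) _)
  -- As `M = 2 s + 1` and `0 ≤ P ≤ s ≤ K₀`, the difference `M - P` lies between `1` and `2 K₀ + 1`
  -- and is at least `P`.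
  have hN : ∀ w ∈ closure (Sig Ω R), 1 ≤ auxM (m + 1) Ω R u - auxP (m + 1) u w := by
    intro w hw
    rw [hM]
    linarith [hPs w hw, hP0 w hw]
  have hHc : ContinuousOn (fun q : Cn n × Cn n => auxH (m + 1) σ Ω R u q.1 q.2)
      (closure (Sig Ω R) ×ˢ sphere 0 1) := by
    rintro ⟨w, η⟩ ⟨hw, -⟩
    simp only at hw
    refine ContinuousAt.continuousWithinAt ?_
    have c1 := continuousAt_levi hU hu (hSU hw) η
    have c2 : ContinuousAt (fun q : Cn n × Cn n => -u q.1) (w, η) :=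
      ((hu.continuousOn.continuousAt (hU.mem_nhds (hSU hw))).comp (f := Prod.fst)
        (x := (w, η)) continuousAt_fst).neg
    have c3 : ContinuousAt (fun q : Cn n × Cn n =>
        auxM (m + 1) Ω R u - auxP (m + 1) u q.1) (w, η) :=
      continuousAt_const.sub ((continuousAt_auxP hU hu (m + 1) (hSU hw) (hneg w hw)).comp
        (f := Prod.fst) (x := (w, η)) continuousAt_fst)
    exact (c1.mul (c2.rpow_const (Or.inl (neg_ne_zero.2 (hneg w hw).ne)))).mul
      (c3.rpow_const (Or.inl (by
        have := hN w hw
        simp only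
        linarith)))
  obtain ⟨z₀, hz₀, ξ₀, hξ₀', hle⟩ := exists_isMax_prod_sphere hcomp hHc hz hξ
  by_cases hfr : z₀ ∈ frontier (Sig Ω R)
  · refine ⟨z₀, hfr, ξ₀, hξ₀', ?_⟩
    have := hle z hz ξ hξ
    have h1 : (1 : ℝ) ≤ max 1 B := le_max_left _ _
    linarith
  have hz₀S : z₀ ∈ Sig Ω R := by
    by_contra h
    exact hfr (by rw [hSopen.frontier_eq]; exact ⟨hz₀, h⟩)
  obtain ⟨v, hv, hvu⟩ := exists_contDiff_eventuallyEq hU hu (hSU hz₀)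
  have hPv := auxP_congr hvu (m + 1)
  have hvz := hvu.self_of_nhds
  have hbound : auxH (m + 1) σ Ω R u z₀ ξ₀ ≤ B := by
    have hnz := hneg z₀ hz₀
    have hest := interior_estimate hkn hσ_pos
      (by
        rw [le_div_iff₀ (by positivity)] at hσ
        linarith)
      hv (contDiff_logf (n := n) hk hkn hε) (z := z₀) (by rw [hvz]; exact hnz)
      (fun i hi hi' => by rw [hessOp_congr hvu]; exact hsol.subharmonic z₀ hz₀S i hi hi')
      (by
        filter_upwards [hvu.eventuallyEq_nhds, hSopen.mem_nhds hz₀S] with w hw hwS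
        rw [hessOp_congr hw, hsol.equation w hwS, logf, Real.exp_log (fEps_pos hk hkn hε w)])
      (M := auxM (m + 1) Ω R u) (N₁ := 2 * K₀ + 1) (K₀ := K₀) (K₁ := K₁) (K₂ := K₂)
      (by rw [hPv]; exact hN z₀ hz₀)
      (by rw [hPv, hM]; linarith [hP0 z₀ hz₀])
      (by rw [hPv, hM]; linarith [hPs z₀ hz₀])
      (by rw [hPv]; exact hP z₀ hz₀)
      (by rw [hvz]; exact hg1 z₀ hz₀)
      (by rw [hvz]; exact hg2 z₀ hz₀) hξ₀'
      (by
        filter_upwards [hvu.eventuallyEq_nhds, hSopen.mem_nhds hz₀S] with w hw hwS η hη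
        rw [levi_congr hw, hw.self_of_nhds, auxP_congr hw, levi_congr hvu, hvz, hPv]
        exact hle w (subset_closure hwS) η hη)
    rw [levi_congr hvu, hvz, hPv] at hest
    exact hest
  -- The interior bound `B` compares with the frontier only because some frontier value of `H` is
  -- nonnegative.
  obtain ⟨z', hz'⟩ := frontier_Sig_nonempty h0Ω ⟨z, hz⟩
  have hz'c := frontier_subset_closure hz'
  obtain ⟨ξ', hξ', hlevi⟩ := exists_unit_levi_nonneg hn hU hSU hu hsub1 hz'c
  refine ⟨z', hz', ξ', hξ', ?_⟩
  have h1 : 0 ≤ auxH (m + 1) σ Ω R u z' ξ' :=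
    mul_nonneg (mul_nonneg hlevi (Real.rpow_nonneg (by linarith [hneg z' hz'c]) _))
      (Real.rpow_nonneg (by linarith [hN z' hz'c]) _)
  have h2 := hle z hz ξ hξ
  have h3 : B ≤ max 1 B := le_max_right _ _
  linarith
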